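/- Consider the static, spherically symmetric metrics, in isotropic coordinates $(x^0,\boldsymbol x)$, $r=|\boldsymbol x|$, $$ds^2=\mathcal A(r)(dx^0)^2-\mathcal B(r)^{-1}\delta_{ij}dx^idx^j,$$ $$\mathcal A(r)=1-\frac{2m}{r}+2\beta\frac{m^2}{r^2}+\cdots,\qquad \frac1{\mathcal B(r)}=1+2\gamma\frac mr+\frac32\epsilon\frac{m^2}{r^2}+\cdots,$$ where $m>0$ is proportional to the gravitational constant $G$, the coefficients of the two power series in $m/r$ are fixed numbers, the series converge and $\mathcal A,\mathcal B^{-1}$ are positive for $r>r_h=km$ ($k>0$ fixed). Put $\kappa=\frac14[8(1+\gamma)-4\beta+3\epsilon]$. Let $\Gamma_s(\boldsymbol N_e,b)$ be a quasi-Minkowskian light ray emitted at infinity in the direction of the unit vector $\boldsymbol N_e$ with impact parameter $b>0$: a future-directed null geodesic contained in $r>r_h$, affinely parametrized by $-\infty<\sigma\le\sigma_R$, with $r\to\infty$ and $d\boldsymbol x/dx^0\to\boldsymbol N_e$ as $\sigma\to-\infty$, which belongs to a family of such geodesics (one for each value of the mass parameter between $0$ and $m$) of the form $$x^0=x^0_R+\sigma-\sigma_R+\sum_{n\ge1}G^nX^0_{(n)}(\sigma),\qquad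 \boldsymbol x=\boldsymbol x_R+(\sigma-\sigma_R)\boldsymbol N_e+\sum_{n\ge1}G^n\boldsymbol X_{(n)}(\sigma),$$ with $X^0_{(n)}(\sigma_R)=0$, $\boldsymbol X_{(n)}(\sigma_R)=0$. With $l_\alpha=g_{\alpha\beta}\,dx^\beta/d\sigma$, its direction triple is $\widehat{\underline{\boldsymbol l}}=(l_i/l_0)$, and $b$ is the magnitude of the angular momentum $-\boldsymbol x\times\widehat{\underline{\boldsymbol l}}$, which is constant along the ray, evaluated in the limit $\sigma\to-\infty$. Let $\boldsymbol x_B$ be any point of the ray such that the half-line $\{\boldsymbol x_B+s\boldsymbol N_e:\ s\le0\}$ is contained in $r>r_h$, and put $\boldsymbol n_B=\boldsymbol x_B/|\boldsymbol x_B|$ and $\boldsymbol P_e=\dfrac{\boldsymbol N_e\times\boldsymbol n_B}{|\boldsymbol N_e\times\boldsymbol n_B|}\times\boldsymbol N_e$. Then the direction triple at $\boldsymbol x_B$ is $$\widehat{\underline{\boldsymbol l}}_{\,r}(\boldsymbol N_e,\boldsymbol x_B)=-\boldsymbol N_e-\frac{m|\boldsymbol N_e\times\boldsymbol n_B|}{b}\left[1+\gamma+\frac{\kappa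 m|\boldsymbol N_e\times\boldsymbol n_B|}{b}\right]\boldsymbol N_e$$ $$+\frac mb\left\{(1+\gamma)(1+\boldsymbol N_e\cdot\boldsymbol n_B)+\frac{\kappa m}{b}\Big[\pi-\arccos(\boldsymbol N_e\cdot\boldsymbol n_B)+|\boldsymbol N_e\times\boldsymbol n_B|\,\boldsymbol N_e\cdot\boldsymbol n_B\Big]\right\}\boldsymbol P_e+O\!\left(\frac{m^3}{b^3}\right)$$ as $m/b\to0$, where the constant implied by $O$ depends only on the coefficients of the metric and on $k$; in particular no term in $1/|\boldsymbol N_e\times\boldsymbol n_B|$ occurs. -/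

import Mathlib

open Filter Topology

noncomputable section

namespace LightRay

/-- Ordered triples, regarded as vectors of the ordinary Euclidean space. -/
abbrev Triple := EuclideanSpace ℝ (Fin 3)

/-- Events, given by their quasi-Cartesian coordinates `(x⁰, x¹, x², x³)`, with `x⁰ = c t`. -/
abbrev Event := Fin 4 → ℝ

/-- The spatial triple `(x¹, x², x³)` of `(x⁰, x¹, x², x³)`. -/
def spatial (x : Event) : Triple := WithLp.toLp 2 (fun i : Fin 3 => x i.succ)

/-- The event with time coordinate `x0` and spatial triple `y`. -/
def event (x0 : ℝ) (y : Triple) : Event := Fin.cons x0 (fun i : Fin 3 => y i)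

/-- The Euclidean exterior (cross) product of triples. -/
def cross (u v : Triple) : Triple :=
  WithLp.toLp 2 (crossProduct (WithLp.ofLp u) (WithLp.ofLp v))

/-- The potentials of a static, spherically symmetric metric in isotropic coordinates, expanded in
powers of `m / r`:
`A(r) = 1 - 2 m/r + 2 β m²/r² + ⋯`, `1/B(r) = 1 + 2 γ m/r + (3/2) ε m²/r² + ⋯`.
The coefficients are dimensionless. Both expansions converge, and the metric is regular
(both potentials are positive), in the exterior region `r > r_h = k m`. -/
structure Potentials where
  /-- coefficients of `A` -/
  a : ℕ → ℝ
  /-- coefficients of `1/B` -/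
  c : ℕ → ℝ
  /-- the parameter `β` -/
  β : ℝ
  /-- the parameter `γ` -/
  γ : ℝ
  /-- the parameter `ε` -/
  ε : ℝ
  /-- the ratio `r_h / m` -/
  k : ℝ
  k_pos : 0 < k
  a_zero : a 0 = 1
  a_one : a 1 = -2
  a_two : a 2 = 2 * β
  c_zero : c 0 = 1
  c_one : c 1 = 2 * γ
  c_two : c 2 = 3 / 2 * ε
  summable_a : ∀ u : ℝ, 0 ≤ u → u < 1 / k → Summable (fun n => a n * u ^ n)
  summable_c : ∀ u : ℝ, 0 ≤ u → u < 1 / k → Summable (fun n => c n * u ^ n)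
  a_pos : ∀ u : ℝ, 0 ≤ u → u < 1 / k → 0 < ∑' n, a n * u ^ n
  c_pos : ∀ u : ℝ, 0 ≤ u → u < 1 / k → 0 < ∑' n, c n * u ^ n

namespace Potentials

variable (S : Potentials)

/-- The potential `A(r)` for the mass parameter `m`. -/
def A (m r : ℝ) : ℝ := ∑' n, S.a n * (m / r) ^ n

/-- The potential `1/B(r)` for the mass parameter `m`. -/
def invB (m r : ℝ) : ℝ := ∑' n, S.c n * (m / r) ^ n

/-- The radius `r_h` bounding the exterior region `D_h`. -/
def rh (m : ℝ) : ℝ := S.k * m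

/-- `κ = (8 (1 + γ) - 4 β + 3 ε) / 4`. -/
def κ : ℝ := (8 * (1 + S.γ) - 4 * S.β + 3 * S.ε) / 4

/-- The components `g_{αβ}` of `ds² = A(r) (dx⁰)² - B(r)⁻¹ δ_{ij} dxⁱ dxʲ`. -/
def metric (m : ℝ) (x : Event) : Matrix (Fin 4) (Fin 4) ℝ :=
  Matrix.diagonal
    (Fin.cons (S.A m ‖spatial x‖) (fun _ : Fin 3 => -S.invB m ‖spatial x‖))

end Potentials

/-- The tangent components `dx^α/dσ` of a curve parametrized by the interval `I`. -/
def tangent (I : Set ℝ) (x : ℝ → Event) (σ : ℝ) : Event := derivWithin x I σ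

/-- The covariant tangent components `l_α = g_{αβ} dx^β/dσ`. -/
def covTangent (g : Event → Matrix (Fin 4) (Fin 4) ℝ) (I : Set ℝ) (x : ℝ → Event) (σ : ℝ)
    (α : Fin 4) : ℝ :=
  ∑ β, g (x σ) α β * tangent I x σ β

/-- `x` is, on the interval `I`, an affinely parametrized future-directed null geodesic of `g`:
`g_{αβ} ẋ^α ẋ^β = 0`, `ẋ⁰ > 0`, and `dl_α/dσ = (1/2) (∂_α g_{μν}) ẋ^μ ẋ^ν`
(the Euler-Lagrange equations of `(1/2) g_{μν} ẋ^μ ẋ^ν`). -/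
structure IsNullGeodesicOn (g : Event → Matrix (Fin 4) (Fin 4) ℝ) (I : Set ℝ)
    (x : ℝ → Event) : Prop where
  differentiable : DifferentiableOn ℝ x I
  null : ∀ σ ∈ I, ∑ α, covTangent g I x σ α * tangent I x σ α = 0
  future : ∀ σ ∈ I, 0 < tangent I x σ 0
  geodesic : ∀ σ ∈ I, ∀ α,
    HasDerivWithinAt (fun s => covTangent g I x s α)
      (1 / 2 * ∑ μ, ∑ ν, fderiv ℝ (fun y => g y μ ν) (x σ) (Pi.single α 1) *
        tangent I x σ μ * tangent I x σ ν) I σ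

/-- The direction triple `(l_1/l_0, l_2/l_0, l_3/l_0)`. -/
def directionTriple (g : Event → Matrix (Fin 4) (Fin 4) ℝ) (I : Set ℝ) (x : ℝ → Event)
    (σ : ℝ) : Triple :=
  WithLp.toLp 2 (fun i : Fin 3 => covTangent g I x σ i.succ / covTangent g I x σ 0)

/-- The angular momentum `L = - x × l̂`. -/
def angularMomentum (g : Event → Matrix (Fin 4) (Fin 4) ℝ) (I : Set ℝ) (x : ℝ → Event)
    (σ : ℝ) : Triple :=
  -cross (spatial (x σ)) (directionTriple g I x σ)

/-- The curve `x`, defined for `-∞ < σ ≤ σR`, comes from infinity in the direction `Ne`: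
`r → ∞` and `d𝐱/dx⁰ → Ne` as `σ → -∞`. -/
def EmittedAtInfinity (Ne : Triple) (σR : ℝ) (x : ℝ → Event) : Prop :=
  Tendsto (fun σ => ‖spatial (x σ)‖) atBot atTop ∧
  Tendsto (fun σ => (tangent (Set.Iic σR) x σ 0)⁻¹ • spatial (tangent (Set.Iic σR) x σ))
    atBot (𝓝 Ne)

/-- `x` (for the mass parameter `m`) is a quasi-Minkowskian light ray emitted at infinity in the
direction `Ne`, ending at the parameter value `σR`: it is the value at `μ = m` of
`x⁰ = x⁰_R + σ - σR + ∑_{n ≥ 1} μⁿ X⁰_n(σ)`, `𝐱 = 𝐱_R + (σ - σR) Ne + ∑_{n ≥ 1} μⁿ 𝐗_n(σ)`,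
`X_n(σR) = 0`, where, for every mass parameter `μ` between `0` and `m`, the series converges to
a null geodesic of the metric with mass parameter `μ` that lies in the exterior region
and comes from infinity in the direction `Ne`. (`m` is proportional to the gravitational constant,
so that power series in the latter are power series in the mass parameter.) -/
def IsQuasiMinkowskian (S : Potentials) (m : ℝ) (Ne : Triple) (σR : ℝ) (x : ℝ → Event) : Prop :=
  ∃ (Γ : ℝ → ℝ → Event) (X : ℕ → ℝ → Event),
    (∀ σ ≤ σR, Γ m σ = x σ) ∧
    (∀ n, 1 ≤ n → X n σR = 0) ∧
    ∀ μ, 0 ≤ μ → μ ≤ m →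
      (∀ σ ≤ σR, HasSum (fun n : ℕ => μ ^ (n + 1) • X (n + 1) σ)
        (Γ μ σ - event (x σR 0 + (σ - σR)) (spatial (x σR) + (σ - σR) • Ne))) ∧
      IsNullGeodesicOn (S.metric μ) (Set.Iic σR) (Γ μ) ∧
      (∀ σ ≤ σR, S.rh μ < ‖spatial (Γ μ σ)‖) ∧
      EmittedAtInfinity Ne σR (Γ μ)

/-- `b` is the impact parameter of the ray: the magnitude of its (conserved) angular momentum,
evaluated at infinity. -/
def HasImpactParameter (S : Potentials) (m : ℝ) (σR : ℝ) (x : ℝ → Event) (b : ℝ) : Prop :=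
  Tendsto (fun σ => ‖angularMomentum (S.metric m) (Set.Iic σR) x σ‖) atBot (𝓝 b)

/-- `n = 𝐱 / |𝐱|`. -/
def unit (y : Triple) : Triple := ‖y‖⁻¹ • y

/-- `P_e = ((Ne × nB) / |Ne × nB|) × Ne`. -/
def Pe (Ne nB : Triple) : Triple := cross (‖cross Ne nB‖⁻¹ • cross Ne nB) Ne

end LightRay

end

/-! A null geodesic of a static isotropic metric is a light ray in a medium whose squared index N =
`S.index` depends only on u = m/r. With p = -l̂ it satisfies x' = w p, |p|² = N, and p' is a central
force proportional to N'(u). So x × p is conserved and the motion is planar. Let z be the coordinate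
along N_e and y the transverse one. The angle φ = π - arccos(z/r) grows from 0 at the rate ω = w
b/r², and the two components of p' are -ω (m/b) (N'/2) times z/r and y/r.

Now N'(u)/2 = 1 + γ + 2κu + O(u²), and b/r = y/r + O(m/b) because p stays within O(m/b) of N_e.
Putting y/r for b/r leaves main terms with explicit primitives in φ, which are the coefficients of
the formula. The error is ω O((m/b)³), and φ never exceeds π, so the bound is uniform however long
the ray is (`IsPlaneRay.direction_expansion`). The inputs are the a priori bounds r ≥ b/2 and |p -
N_e| = O(m/b), obtained by continuation from σ = -∞ (`IsRay.far_of_angular`,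
`IsRay.norm_sub_direction_le`).

The other difficulty is a sign. The formula measures transversality by |N_e × n_B|, so y > 0 is
needed along the ray: it must not have crossed the axis behind the centre. Here the family in the
mass parameter enters (`inner_angular_pos_of_family`). At mass zero the ray is a straight line. All
members share their end and incoming direction, and the sign of the angular momentum relative to x_R
× N_e is locally constant and never vanishes unless the end is on the axis. -/

namespace LightRay

/-! ### Real power series and their cubic remainders -/

/-- The sum of the real power series with coefficients `a`. -/
noncomputable def powerSum (a : ℕ → ℝ) (u : ℝ) : ℝ := ∑' n, a n * u ^ n

theorem summable_mul_pow_of_abs_lt {a : ℕ → ℝ} {R u : ℝ}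
    (h : ∀ u : ℝ, 0 ≤ u → u < R → Summable fun n => a n * u ^ n) (hu : |u| < R) :
    Summable fun n => a n * u ^ n := by
  have := h |u| (abs_nonneg u) hu
  rw [← summable_abs_iff] at this ⊢
  simpa [abs_mul, abs_pow] using this

/-- Summability at every nonnegative radius below R forces the radius of convergence to be at least
R. -/
theorem analyticOnNhd_powerSum {a : ℕ → ℝ} {R : ℝ} (hR : 0 < R)
    (h : ∀ u : ℝ, 0 ≤ u → u < R → Summable fun n => a n * u ^ n) :
    AnalyticOnNhd ℝ (powerSum a) (Metric.ball 0 R) := by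
  have hrad : ENNReal.ofReal R ≤ (FormalMultilinearSeries.ofScalars ℝ a).radius := by
    refine ENNReal.le_of_forall_nnreal_lt fun r hr => ?_
    have hr' : (r : ℝ) < R := by
      rw [← ENNReal.ofReal_coe_nnreal] at hr
      exact (ENNReal.ofReal_lt_ofReal_iff hR).1 hr
    apply FormalMultilinearSeries.le_radius_of_summable
    have := h r r.2 hr'
    rw [← summable_abs_iff] at this
    simpa [abs_mul, abs_pow, FormalMultilinearSeries.ofScalars_norm] using this
  have hsum : (FormalMultilinearSeries.ofScalars ℝ a).sum = powerSum a := by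
    funext u
    have := congrFun (FormalMultilinearSeries.ofScalarsSum_eq_tsum (E := ℝ) a) u
    rw [FormalMultilinearSeries.ofScalarsSum] at this
    simpa [powerSum, smul_eq_mul] using this
  have hball := (FormalMultilinearSeries.ofScalars ℝ a).hasFPowerSeriesOnBall
    (lt_of_lt_of_le (ENNReal.ofReal_pos.2 hR) hrad)
  rw [hsum] at hball
  refine hball.analyticOnNhd.mono ?_
  rw [← Metric.eball_ofReal]
  exact Metric.eball_subset_eball hrad

theorem powerSum_eq_add_cube {a : ℕ → ℝ} {R u : ℝ}
    (h : ∀ u : ℝ, 0 ≤ u → u < R → Summable fun n => a n * u ^ n) (hu : |u| < R) :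
    powerSum a u =
      a 0 + a 1 * u + a 2 * u ^ 2 + u ^ 3 * powerSum (fun n => a (n + 3)) u := by
  have hs := summable_mul_pow_of_abs_lt h hu
  rw [powerSum, ← hs.sum_add_tsum_nat_add 3, powerSum, ← tsum_mul_left]
  congr 1
  · simp [Finset.sum_range_succ]
  · exact tsum_congr fun n => by ring

theorem summable_shift_three {a : ℕ → ℝ} {R : ℝ} (hR : 0 < R)
    (h : ∀ u : ℝ, 0 ≤ u → u < R → Summable fun n => a n * u ^ n) :
    ∀ u : ℝ, 0 ≤ u → u < R → Summable fun n => a (n + 3) * u ^ n := by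
  have key : ∀ u : ℝ, 0 < u → u < R → Summable fun n => a (n + 3) * u ^ n := by
    intro u h0 hu
    have := ((summable_nat_add_iff 3).2 (h u h0.le hu)).mul_left ((u ^ 3)⁻¹)
    refine this.congr fun n => ?_
    field_simp
    ring
  intro u h0 hu
  -- At u = 0 one cannot divide by u³, so the series is dominated by the one at the positive
  -- midpoint of u and R.
  have h2 := key ((u + R) / 2) (by linarith) (by linarith)
  have h3 : Summable fun n => |a (n + 3) * ((u + R) / 2) ^ n| := summable_abs_iff.2 h2
  refine Summable.of_norm_bounded h3 fun n => ?_
  rw [Real.norm_eq_abs, abs_mul, abs_mul, abs_of_nonneg (pow_nonneg h0 n),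
    abs_of_nonneg (pow_nonneg (by linarith : 0 ≤ (u + R) / 2) n)]
  have : u ^ n ≤ ((u + R) / 2) ^ n := pow_le_pow_left₀ h0 (by linarith) n
  exact mul_le_mul_of_nonneg_left this (abs_nonneg _)

/-! ### The squared refractive index and its expansion at infinity -/

namespace Potentials

variable (S : Potentials)

/-- The square of the refractive index, `1 / (A B)`, as a function of `u = m / r`. -/
noncomputable def index (u : ℝ) : ℝ := powerSum S.c u / powerSum S.a u

theorem inv_k_pos : 0 < 1 / S.k := one_div_pos.2 S.k_pos

theorem analyticAt_a {u : ℝ} (h0 : 0 ≤ u) (h1 : u < 1 / S.k) : AnalyticAt ℝ (powerSum S.a) u :=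
  analyticOnNhd_powerSum S.inv_k_pos S.summable_a u (by simpa [abs_of_nonneg h0] using h1)

theorem analyticAt_c {u : ℝ} (h0 : 0 ≤ u) (h1 : u < 1 / S.k) : AnalyticAt ℝ (powerSum S.c) u :=
  analyticOnNhd_powerSum S.inv_k_pos S.summable_c u (by simpa [abs_of_nonneg h0] using h1)

theorem powerSum_a_pos {u : ℝ} (h0 : 0 ≤ u) (h1 : u < 1 / S.k) : 0 < powerSum S.a u :=
  S.a_pos u h0 h1

theorem powerSum_c_pos {u : ℝ} (h0 : 0 ≤ u) (h1 : u < 1 / S.k) : 0 < powerSum S.c u :=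
  S.c_pos u h0 h1

theorem index_pos {u : ℝ} (h0 : 0 ≤ u) (h1 : u < 1 / S.k) : 0 < S.index u :=
  div_pos (S.powerSum_c_pos h0 h1) (S.powerSum_a_pos h0 h1)

theorem analyticAt_index {u : ℝ} (h0 : 0 ≤ u) (h1 : u < 1 / S.k) : AnalyticAt ℝ S.index u :=
  (S.analyticAt_c h0 h1).div (S.analyticAt_a h0 h1) (S.powerSum_a_pos h0 h1).ne'

theorem deriv_index {u : ℝ} (h0 : 0 ≤ u) (h1 : u < 1 / S.k) :
    deriv S.index u =
      (deriv (powerSum S.c) u * powerSum S.a u - powerSum S.c u * deriv (powerSum S.a) u) /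
        powerSum S.a u ^ 2 :=
  ((S.analyticAt_c h0 h1).differentiableAt.hasDerivAt.div
    (S.analyticAt_a h0 h1).differentiableAt.hasDerivAt (S.powerSum_a_pos h0 h1).ne').deriv

theorem powerSum_zero (a : ℕ → ℝ) : powerSum a 0 = a 0 := by
  rw [powerSum, tsum_eq_single 0 (fun n hn => by simp [hn])]
  simp

theorem index_zero : S.index 0 = 1 := by
  simp [index, powerSum_zero, S.a_zero, S.c_zero]

theorem deriv_powerSum_eq {a : ℕ → ℝ} {R u : ℝ} (hR : 0 < R)
    (h : ∀ u : ℝ, 0 ≤ u → u < R → Summable fun n => a n * u ^ n) (hu : |u| < R) :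
    deriv (powerSum a) u = a 1 + 2 * a 2 * u + u ^ 2 *
      (3 * powerSum (fun n => a (n + 3)) u + u * deriv (powerSum fun n => a (n + 3)) u) := by
  have hmem : u ∈ Metric.ball (0 : ℝ) R := by simpa using hu
  have hev : powerSum a =ᶠ[𝓝 u] fun u =>
      a 0 + a 1 * u + a 2 * u ^ 2 + u ^ 3 * powerSum (fun n => a (n + 3)) u := by
    filter_upwards [Metric.isOpen_ball.mem_nhds hmem] with v hv
    exact powerSum_eq_add_cube h (by simpa using hv)
  have hd := (analyticOnNhd_powerSum hR (summable_shift_three hR h) u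
    hmem).differentiableAt.hasDerivAt
  have h1 := ((((hasDerivAt_id u).const_mul (a 1)).const_add (a 0)).add
    ((hasDerivAt_pow 2 u).const_mul (a 2))).add ((hasDerivAt_pow 3 u).mul hd)
  have h2 : HasDerivAt (fun u =>
      a 0 + a 1 * u + a 2 * u ^ 2 + u ^ 3 * powerSum (fun n => a (n + 3)) u) _ u := h1
  rw [hev.deriv_eq, h2.deriv]
  simp
  ring

/-- Second order expansion of the squared refractive index near infinity. -/
theorem exists_deriv_index_bound :
    ∃ u₀ K : ℝ, 0 < u₀ ∧ u₀ < 1 / S.k ∧ 0 ≤ K ∧ ∀ u, 0 ≤ u → u ≤ u₀ →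
      S.index u ≤ 4 ∧ |deriv S.index u - (2 * (1 + S.γ) + 4 * S.κ * u)| ≤ K * u ^ 2 := by
  have hk := S.inv_k_pos
  have hcont : ContinuousAt S.index 0 := (S.analyticAt_index le_rfl hk).continuousAt
  have hev : ∀ᶠ u in 𝓝 (0 : ℝ), S.index u < 4 :=
    hcont.eventually_lt continuousAt_const (by rw [S.index_zero]; norm_num)
  obtain ⟨d, hd, hd4⟩ := Metric.eventually_nhds_iff.1 hev
  -- The first entry keeps the index below 4, hence |p| ≤ 2 later on; the second keeps [0, u₀] a
  -- compact subset of the disc of convergence.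
  set u₀ := min (d / 2) (1 / S.k / 2) with hu₀
  have hu₀pos : 0 < u₀ := lt_min (by linarith) (by linarith)
  have hu₀d : u₀ < d := (min_le_left _ _).trans_lt (by linarith)
  have hu₀k : u₀ < 1 / S.k := (min_le_right _ _).trans_lt (by linarith)
  set Ra := powerSum fun n => S.a (n + 3)
  set Rc := powerSum fun n => S.c (n + 3)
  have hRa := analyticOnNhd_powerSum hk (summable_shift_three hk S.summable_a)
  have hRc := analyticOnNhd_powerSum hk (summable_shift_three hk S.summable_c)
  have hsub : Set.Icc 0 u₀ ⊆ Metric.ball (0 : ℝ) (1 / S.k) := fun u hu => by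
    simpa [abs_of_nonneg hu.1] using hu.2.trans_lt hu₀k
  have cRa : ContinuousOn Ra (Set.Icc 0 u₀) := hRa.continuousOn.mono hsub
  have cRc : ContinuousOn Rc (Set.Icc 0 u₀) := hRc.continuousOn.mono hsub
  have cRa' : ContinuousOn (deriv Ra) (Set.Icc 0 u₀) := hRa.deriv.continuousOn.mono hsub
  have cRc' : ContinuousOn (deriv Rc) (Set.Icc 0 u₀) := hRc.deriv.continuousOn.mono hsub
  have ca : ContinuousOn (powerSum S.a) (Set.Icc 0 u₀) := fun u hu =>
    (S.analyticAt_a hu.1 (hu.2.trans_lt hu₀k)).continuousAt.continuousWithinAt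
  set a2 := 2 * S.β with ha2
  set c1 := 2 * S.γ with hc1
  set c2 := 3 / 2 * S.ε with hc2
  set l0 := 2 + c1 with hl0
  set l1 := 8 + 4 * c1 - 2 * a2 + 2 * c2 with hl1
  -- Here `l0` = 2(1 + γ) and `l1` = 4κ. The numerator c'a - ca' - (l0 + l1 u)a² is divisible by u²;
  -- `G` is the quotient over a², and its continuity on [0, u₀] supplies K.
  let G : ℝ → ℝ := fun u =>
    ((-a2 * c1 - 2 * c2) - (l0 * (4 + 2 * a2) - 4 * l1)
      - (-4 * a2 * l0 + l1 * (4 + 2 * a2)) * u - (l0 * a2 ^ 2 - 4 * a2 * l1) * u ^ 2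
      - l1 * a2 ^ 2 * u ^ 3
      + (3 * Rc u + u * deriv Rc u) * (1 - 2 * u + a2 * u ^ 2)
      + u * Ra u * (c1 + 2 * c2 * u) + u ^ 3 * (3 * Rc u + u * deriv Rc u) * Ra u
      - (1 + c1 * u + c2 * u ^ 2) * (3 * Ra u + u * deriv Ra u)
      - u * Rc u * (-2 + 2 * a2 * u) - u ^ 3 * Rc u * (3 * Ra u + u * deriv Ra u)
      - (l0 + l1 * u) * (2 * u * (1 - 2 * u + a2 * u ^ 2) * Ra u + u ^ 4 * Ra u ^ 2)) /
    powerSum S.a u ^ 2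
  have cG : ContinuousOn G (Set.Icc 0 u₀) := by
    apply ContinuousOn.div
    · fun_prop
    · fun_prop
    · intro u hu
      exact pow_ne_zero _ (S.powerSum_a_pos hu.1 (hu.2.trans_lt hu₀k)).ne'
  obtain ⟨K, hK⟩ := isCompact_Icc.exists_bound_of_continuousOn cG
  have hK0 : 0 ≤ K := (norm_nonneg _).trans (hK 0 ⟨le_rfl, hu₀pos.le⟩)
  refine ⟨u₀, K, hu₀pos, hu₀k, hK0, fun u h0 h1 => ⟨?_, ?_⟩⟩
  · exact (hd4 (by simpa [abs_of_nonneg h0] using h1.trans_lt hu₀d)).le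
  · have huk : u < 1 / S.k := h1.trans_lt hu₀k
    have habs : |u| < 1 / S.k := by rwa [abs_of_nonneg h0]
    have ea := powerSum_eq_add_cube S.summable_a habs
    have ec := powerSum_eq_add_cube S.summable_c habs
    have ea' := deriv_powerSum_eq hk S.summable_a habs
    have ec' := deriv_powerSum_eq hk S.summable_c habs
    rw [S.a_zero, S.a_one, S.a_two] at ea
    rw [S.a_one, S.a_two] at ea'
    rw [S.c_zero, S.c_one, S.c_two] at ec
    rw [S.c_one, S.c_two] at ec'
    have hpos := S.powerSum_a_pos h0 huk
    have key : deriv S.index u - (2 * (1 + S.γ) + 4 * S.κ * u) = G u * u ^ 2 := by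
      rw [S.deriv_index h0 huk]
      simp only [G]
      rw [div_mul_eq_mul_div, div_sub' (pow_ne_zero _ hpos.ne')]
      congr 1
      rw [ea, ec, ea', ec', κ]
      simp only [hl0, hl1, ha2, hc1, hc2, Ra, Rc]
      ring
    rw [key, abs_mul, abs_of_nonneg (sq_nonneg u)]
    exact mul_le_mul_of_nonneg_right (hK u ⟨h0, h1⟩) (sq_nonneg u)

end Potentials
-- Vector algebra of triples
theorem cross_apply_zero (u v : Triple) : cross u v 0 = u 1 * v 2 - u 2 * v 1 := by
  simp [cross, cross_apply]

theorem cross_apply_one (u v : Triple) : cross u v 1 = u 2 * v 0 - u 0 * v 2 := by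
  simp [cross, cross_apply]

theorem cross_apply_two (u v : Triple) : cross u v 2 = u 0 * v 1 - u 1 * v 0 := by
  simp [cross, cross_apply]

theorem inner_triple (u v : Triple) :
    inner ℝ u v = u 0 * v 0 + u 1 * v 1 + u 2 * v 2 := by
  simp [PiLp.inner_apply, Fin.sum_univ_three, mul_comm]

theorem triple_ext {u v : Triple} (h0 : u 0 = v 0) (h1 : u 1 = v 1) (h2 : u 2 = v 2) : u = v := by
  ext i
  fin_cases i <;> assumption

theorem cross_self_eq_zero (u : Triple) : cross u u = 0 := by
  apply triple_ext <;> simp [cross_apply_zero, cross_apply_one, cross_apply_two] <;> ring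

theorem cross_smul_left (t : ℝ) (u v : Triple) : cross (t • u) v = t • cross u v := by
  apply triple_ext <;> simp [cross_apply_zero, cross_apply_one, cross_apply_two] <;> ring

theorem cross_smul_right (t : ℝ) (u v : Triple) : cross u (t • v) = t • cross u v := by
  apply triple_ext <;> simp [cross_apply_zero, cross_apply_one, cross_apply_two] <;> ring

theorem cross_zero_left (u : Triple) : cross 0 u = 0 := by
  apply triple_ext <;> simp [cross_apply_zero, cross_apply_one, cross_apply_two]

theorem cross_zero_right (u : Triple) : cross u 0 = 0 := by
  apply triple_ext <;> simp [cross_apply_zero, cross_apply_one, cross_apply_two]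

theorem cross_add_right (u v w : Triple) : cross u (v + w) = cross u v + cross u w := by
  apply triple_ext <;> simp [cross_apply_zero, cross_apply_one, cross_apply_two] <;> ring

theorem cross_neg_right (u v : Triple) : cross u (-v) = -cross u v := by
  apply triple_ext <;> simp [cross_apply_zero, cross_apply_one, cross_apply_two] <;> ring

theorem cross_swap (u v : Triple) : cross u v = -cross v u := by
  apply triple_ext <;> simp [cross_apply_zero, cross_apply_one, cross_apply_two] <;> ring

theorem inner_cross_self_left (u v : Triple) : inner ℝ (cross u v) u = (0 : ℝ) := by
  rw [inner_triple, cross_apply_zero, cross_apply_one, cross_apply_two]; ring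

theorem inner_cross_self_right (u v : Triple) : inner ℝ (cross u v) v = (0 : ℝ) := by
  rw [inner_triple, cross_apply_zero, cross_apply_one, cross_apply_two]; ring

theorem inner_cross_cross (u v w t : Triple) :
    inner ℝ (cross u v) (cross w t) =
      (inner ℝ u w * inner ℝ v t - inner ℝ u t * inner ℝ v w : ℝ) := by
  simp only [inner_triple, cross_apply_zero, cross_apply_one, cross_apply_two]; ring

theorem inner_cross_rotate (u v w : Triple) :
    inner ℝ (cross u v) w = (inner ℝ u (cross v w) : ℝ) := by
  simp only [inner_triple, cross_apply_zero, cross_apply_one, cross_apply_two]; ring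

theorem cross_cross_left (u v w : Triple) :
    cross (cross u v) w = (inner ℝ u w : ℝ) • v - (inner ℝ v w : ℝ) • u := by
  apply triple_ext <;>
    simp [inner_triple, cross_apply_zero, cross_apply_one, cross_apply_two] <;> ring

theorem norm_cross_sq (u v : Triple) :
    ‖cross u v‖ ^ 2 = ‖u‖ ^ 2 * ‖v‖ ^ 2 - (inner ℝ u v : ℝ) ^ 2 := by
  rw [← real_inner_self_eq_norm_sq, inner_cross_cross, real_inner_self_eq_norm_sq,
    real_inner_self_eq_norm_sq, real_inner_comm u v]
  ring

theorem norm_cross_le (u v : Triple) : ‖cross u v‖ ≤ ‖u‖ * ‖v‖ := by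
  apply le_of_sq_le_sq _ (by positivity)
  rw [norm_cross_sq, mul_pow]
  nlinarith [sq_nonneg (inner ℝ u v : ℝ)]

theorem continuous_cross : Continuous fun q : Triple × Triple => cross q.1 q.2 := by
  rw [show (fun q : Triple × Triple => cross q.1 q.2) = fun q =>
      WithLp.toLp 2 ![q.1 1 * q.2 2 - q.1 2 * q.2 1, q.1 2 * q.2 0 - q.1 0 * q.2 2,
        q.1 0 * q.2 1 - q.1 1 * q.2 0] from by funext q; simp [cross, cross_apply]]
  apply (PiLp.continuous_toLp 2 _).comp
  refine continuous_pi fun i => ?_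
  fin_cases i <;> simp <;> fun_prop

theorem tendsto_cross {α : Type*} {l : Filter α} {f g : α → Triple} {u v : Triple}
    (hf : Tendsto f l (𝓝 u)) (hg : Tendsto g l (𝓝 v)) :
    Tendsto (fun t => cross (f t) (g t)) l (𝓝 (cross u v)) :=
  Tendsto.comp (f := fun t => (f t, g t)) (continuous_cross.tendsto (u, v))
    (hf.prodMk_nhds hg)

theorem hasDerivWithinAt_triple {f : ℝ → Triple} {f' : Triple} {s : Set ℝ} {t : ℝ} :
    HasDerivWithinAt f f' s t ↔ ∀ i, HasDerivWithinAt (fun σ => f σ i) (f' i) s t := by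
  rw [hasDerivWithinAt_iff_hasFDerivWithinAt, hasFDerivWithinAt_euclidean]
  refine forall_congr' fun i => ?_
  rw [hasFDerivWithinAt_iff_hasDerivWithinAt]
  have : (PiLp.proj 2 (fun _ : Fin 3 => ℝ) i ∘SL ContinuousLinearMap.toSpanSingleton ℝ f') 1
      = f' i := by simp
  rw [← this]

theorem hasDerivWithinAt_cross {f g : ℝ → Triple} {f' g' : Triple} {s : Set ℝ} {t : ℝ}
    (hf : HasDerivWithinAt f f' s t) (hg : HasDerivWithinAt g g' s t) :
    HasDerivWithinAt (fun σ => cross (f σ) (g σ)) (cross f' (g t) + cross (f t) g') s t := by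
  have hfi := hasDerivWithinAt_triple.1 hf
  have hgi := hasDerivWithinAt_triple.1 hg
  rw [hasDerivWithinAt_triple]
  intro i
  fin_cases i
  · simp only [Fin.zero_eta, cross_apply_zero]
    refine (((hfi 1).mul (hgi 2)).sub ((hfi 2).mul (hgi 1))).congr_deriv ?_
    simp [cross_apply_zero]; ring
  · simp only [Fin.mk_one, cross_apply_one]
    refine (((hfi 2).mul (hgi 0)).sub ((hfi 0).mul (hgi 2))).congr_deriv ?_
    simp [cross_apply_one]; ring
  · simp only [Fin.reduceFinMk, cross_apply_two]
    refine (((hfi 0).mul (hgi 1)).sub ((hfi 1).mul (hgi 0))).congr_deriv ?_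
    simp [cross_apply_two]; ring

/-- Expansion of a vector in the orthonormal basis `N`, `N × M`, `M`. -/
theorem eq_smul_add_smul_of_orthonormal {N M v : Triple} (hN : ‖N‖ = 1) (hM : ‖M‖ = 1)
    (hNM : inner ℝ N M = (0 : ℝ)) (hv : inner ℝ v M = (0 : ℝ)) :
    v = (inner ℝ v N : ℝ) • N + (inner ℝ v (cross N M) : ℝ) • cross N M := by
  set e := cross N M with he
  have hee : inner ℝ e e = (1 : ℝ) := by
    rw [real_inner_self_eq_norm_sq, he, norm_cross_sq, hN, hM, hNM]; norm_num
  -- Computing (e × v) × e in two ways, with v ⟂ M, gives the decomposition.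
  have h1 : cross e v = (inner ℝ N v : ℝ) • M - (inner ℝ M v : ℝ) • N := cross_cross_left N M v
  have hMv : inner ℝ M v = (0 : ℝ) := by rw [real_inner_comm]; exact hv
  rw [hMv, zero_smul, sub_zero] at h1
  have h2 : cross (cross e v) e = (inner ℝ e e : ℝ) • v - (inner ℝ v e : ℝ) • e :=
    cross_cross_left e v e
  have h3 : cross M e = N := by
    rw [cross_swap, he, cross_cross_left, hNM, real_inner_self_eq_norm_sq, hM]
    simp
  rw [h1, cross_smul_left, h3, hee, one_smul, real_inner_comm] at h2
  rw [h2]; simp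

/-! ### Mean value inequalities and continuation on half-lines -/

section MeanValue

variable {E : Type*} [NormedAddCommGroup E] [NormedSpace ℝ E]

/-- Derivatives relative to (-∞, T] are two-sided to the left of T, so the classical inequality
applies up to and including b = T. The function g serves as an explicit primitive of the bound, so
nothing has to be integrated. -/
theorem norm_sub_le_sub_of_norm_deriv_le {f f' : ℝ → E} {g g' : ℝ → ℝ} {T a b : ℝ} (hab : a ≤ b)
    (hb : b ≤ T) (hf : ∀ σ, a ≤ σ → σ ≤ b → HasDerivWithinAt f (f' σ) (Set.Iic T) σ)
    (hg : ∀ σ, a ≤ σ → σ ≤ b → HasDerivWithinAt g (g' σ) (Set.Iic T) σ)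
    (h : ∀ σ, a ≤ σ → σ < b → ‖f' σ‖ ≤ g' σ) : ‖f b - f a‖ ≤ g b - g a := by
  have hsub : Set.Icc a b ⊆ Set.Iic T := fun σ hσ => hσ.2.trans hb
  have hfc : ContinuousOn f (Set.Icc a b) := fun σ hσ =>
    (hf σ hσ.1 hσ.2).continuousWithinAt.mono hsub
  have hgc : ContinuousOn g (Set.Icc a b) := fun σ hσ =>
    (hg σ hσ.1 hσ.2).continuousWithinAt.mono hsub
  refine image_norm_le_of_norm_deriv_right_le_deriv_boundary' (f := fun σ => f σ - f a)
    (f' := f') (a := a) (b := b) (B := fun σ => g σ - g a) (B' := g')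
    (hfc.sub continuousOn_const) ?_ (by simp) (hgc.sub continuousOn_const) ?_
    (fun σ hσ => h σ hσ.1 hσ.2) ⟨hab, le_rfl⟩
  · intro σ hσ
    exact (((hf σ hσ.1 hσ.2.le).hasDerivAt
      (Iic_mem_nhds (hσ.2.trans_le hb))).sub_const _).hasDerivWithinAt
  · intro σ hσ
    exact (((hg σ hσ.1 hσ.2.le).hasDerivAt
      (Iic_mem_nhds (hσ.2.trans_le hb))).sub_const _).hasDerivWithinAt

/-- The mean value inequality on a half-line, starting from limits at `-∞`. -/
theorem norm_sub_le_sub_of_tendsto_atBot {f f' : ℝ → E} {g g' : ℝ → ℝ} {T b : ℝ} {f₀ : E} {g₀ : ℝ}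
    (hb : b ≤ T) (hf : ∀ σ, σ ≤ b → HasDerivWithinAt f (f' σ) (Set.Iic T) σ)
    (hg : ∀ σ, σ ≤ b → HasDerivWithinAt g (g' σ) (Set.Iic T) σ)
    (h : ∀ σ, σ < b → ‖f' σ‖ ≤ g' σ) (hf₀ : Tendsto f atBot (𝓝 f₀))
    (hg₀ : Tendsto g atBot (𝓝 g₀)) : ‖f b - f₀‖ ≤ g b - g₀ := by
  refine le_of_tendsto_of_tendsto (tendsto_const_nhds.sub hf₀).norm
    (tendsto_const_nhds.sub hg₀) ?_
  filter_upwards [eventually_le_atBot b] with a ha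
  exact norm_sub_le_sub_of_norm_deriv_le ha hb (fun σ _ h2 => hf σ h2) (fun σ _ h2 => hg σ h2)
    (fun σ _ h2 => h σ h2)

theorem eq_of_deriv_eq_zero {f : ℝ → E} {T a b : ℝ} (ha : a ≤ T) (hb : b ≤ T)
    (hf : ∀ σ, σ ≤ T → HasDerivWithinAt f 0 (Set.Iic T) σ) : f a = f b := by
  wlog hab : a ≤ b generalizing a b
  · exact (this hb ha (le_of_not_ge hab)).symm
  have := norm_sub_le_sub_of_norm_deriv_le (f := f) (f' := fun _ => 0) (g := fun _ => 0)
    (g' := fun _ => 0) hab hb (fun σ _ h => hf σ (h.trans hb))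
    (fun σ _ _ => hasDerivWithinAt_const _ _ _) (fun _ _ _ => by simp)
  rw [sub_zero] at this
  exact (sub_eq_zero.1 (norm_le_zero_iff.1 this)).symm

end MeanValue

theorem lt_of_deriv_pos {f f' : ℝ → ℝ} {T a b : ℝ} (hab : a < b) (hb : b ≤ T)
    (hf : ∀ σ, a ≤ σ → σ ≤ b → HasDerivWithinAt f (f' σ) (Set.Iic T) σ)
    (h : ∀ σ, a < σ → σ < b → 0 < f' σ) : f a < f b := by
  have hsub : Set.Icc a b ⊆ Set.Iic T := fun σ hσ => hσ.2.trans hb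
  refine strictMonoOn_of_hasDerivWithinAt_pos (convex_Icc a b)
    (fun σ hσ => (hf σ hσ.1 hσ.2).continuousWithinAt.mono hsub) (f' := f') ?_ ?_
    ⟨le_rfl, hab.le⟩ ⟨hab.le, le_rfl⟩ hab
  · intro σ hσ
    rw [interior_Icc] at hσ ⊢
    exact (hf σ hσ.1.le hσ.2.le).mono fun τ hτ => hsub (Set.Ioo_subset_Icc_self hτ)
  · intro σ hσ
    rw [interior_Icc] at hσ
    exact h σ hσ.1 hσ.2

/-- A continuous real function on `(-∞, T]` that is eventually below `C` at `-∞`, and that can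
only be below `C` at the end of any interval on which it is below `C`, is below `C`. -/
theorem lt_of_continuation {f : ℝ → ℝ} {C T : ℝ} (hf : ContinuousOn f (Set.Iic T))
    (h0 : ∀ᶠ σ in atBot, f σ < C)
    (h : ∀ τ ≤ T, (∀ σ < τ, f σ < C) → f τ < C) : ∀ σ ≤ T, f σ < C := by
  by_contra hcon
  push Not at hcon
  obtain ⟨σ₁, hσ₁, hfσ₁⟩ := hcon
  obtain ⟨A, hA⟩ := eventually_atBot.1 h0
  let s : Set ℝ := {σ | σ ∈ Set.Icc A T ∧ C ≤ f σ}
  have hA1 : A ≤ σ₁ := by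
    by_contra hlt
    exact absurd (hA σ₁ (le_of_not_ge hlt)) (not_lt.2 hfσ₁)
  have hs : IsCompact s := by
    refine isCompact_Icc.of_isClosed_subset ?_ (fun σ hσ => hσ.1)
    have := (hf.mono (fun σ (hσ : σ ∈ Set.Icc A T) => hσ.2)).preimage_isClosed_of_isClosed
      isClosed_Icc (isClosed_Ici (a := C))
    exact this
  -- The first failure exists by compactness, and the bound holds everywhere before it.
  obtain ⟨τ, hτ⟩ := hs.exists_isLeast ⟨σ₁, ⟨hA1, hσ₁⟩, hfσ₁⟩
  refine absurd (h τ hτ.1.1.2 fun σ hσ => ?_) (not_lt.2 hτ.1.2)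
  by_contra hge
  have hAσ : A ≤ σ := by
    by_contra hlt
    exact hge (hA σ (le_of_not_ge hlt))
  exact absurd (hτ.2 ⟨⟨hAσ, hσ.le.trans hτ.1.1.2⟩, not_lt.1 hge⟩) (not_le.2 hσ)

/-! ### From null geodesics to rays of an optical medium -/

/-- The optical form of the null geodesic equations: `p` is the ray covector divided by its
time component, up to sign, and `w` the speed of the parametrization. -/
structure IsRay (S : Potentials) (μ : ℝ) (Ne : Triple) (T : ℝ) (x p : ℝ → Triple)
    (w τ : ℝ → ℝ) : Prop where
  outside : ∀ σ ≤ T, S.k * μ < ‖x σ‖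
  w_pos : ∀ σ ≤ T, 0 < w σ
  deriv_x : ∀ σ ≤ T, HasDerivWithinAt x (w σ • p σ) (Set.Iic T) σ
  deriv_p : ∀ σ ≤ T, HasDerivWithinAt p
    ((-(w σ * μ / (2 * ‖x σ‖ ^ 3) * deriv S.index (μ / ‖x σ‖))) • x σ) (Set.Iic T) σ
  deriv_time : ∀ σ ≤ T, HasDerivWithinAt τ (w σ * S.index (μ / ‖x σ‖)) (Set.Iic T) σ
  norm_sq_p : ∀ σ ≤ T, ‖p σ‖ ^ 2 = S.index (μ / ‖x σ‖)
  tendsto_x : Tendsto (fun σ => ‖x σ‖) atBot atTop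
  tendsto_p : Tendsto p atBot (𝓝 Ne)

theorem spatial_apply (y : Event) (i : Fin 3) : spatial y i = y i.succ := rfl

theorem norm_spatial_sq (y : Event) : ‖spatial y‖ ^ 2 = ∑ i : Fin 3, y i.succ ^ 2 := by
  rw [EuclideanSpace.real_norm_sq_eq]
  rfl

theorem hasFDerivAt_norm_spatial {y : Event} (hy : 0 < ‖spatial y‖) :
    ∃ L : Event →L[ℝ] ℝ, HasFDerivAt (fun z => ‖spatial z‖) L y ∧
      L (Pi.single 0 1) = 0 ∧ ∀ i : Fin 3, L (Pi.single i.succ 1) = y i.succ / ‖spatial y‖ := by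
  have h1 : HasFDerivAt (fun z : Event => ∑ i : Fin 3, z i.succ ^ 2)
      (∑ i : Fin 3, (2 * y i.succ) • ContinuousLinearMap.proj (R := ℝ) (φ := fun _ => ℝ) i.succ)
      y := by
    refine HasFDerivAt.fun_sum fun i _ => ?_
    have := (hasFDerivAt_apply (𝕜 := ℝ) (F' := fun _ : Fin 4 => ℝ) i.succ y).pow 2
    simpa using this
  have h2 := h1.sqrt (by rw [← norm_spatial_sq]; positivity)
  have h3 : (fun z : Event => √(∑ i : Fin 3, z i.succ ^ 2)) = fun z => ‖spatial z‖ := by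
    funext z
    rw [← norm_spatial_sq, Real.sqrt_sq (norm_nonneg _)]
  have h4 := congrFun h3 y
  rw [h3, h4] at h2
  refine ⟨_, h2, ?_, fun i => ?_⟩
  · simp
  · simp only [smul_apply, sum_apply,
      ContinuousLinearMap.proj_apply, smul_eq_mul]
    rw [Finset.sum_eq_single i]
    · simp; field_simp
    · intro j _ hj
      rw [Pi.single_eq_of_ne (by simpa using hj)]; simp
    · simp

theorem hasDerivAt_powerSum_div {a : ℕ → ℝ} {μ r : ℝ} (hr : 0 < r)
    (h : AnalyticAt ℝ (powerSum a) (μ / r)) :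
    HasDerivAt (fun s => powerSum a (μ / s)) (deriv (powerSum a) (μ / r) * (-μ / r ^ 2)) r := by
  have h1 : HasDerivAt (fun s => μ / s) (-μ / r ^ 2) r := by
    refine ((hasDerivAt_const r μ).div (hasDerivAt_id r) hr.ne').congr_deriv ?_
    simp
  exact h.differentiableAt.hasDerivAt.comp r h1

theorem div_lt_inv_of_outside {k μ r : ℝ} (hk : 0 < k) (hμ : 0 ≤ μ) (h : k * μ < r) :
    0 < r ∧ 0 ≤ μ / r ∧ μ / r < 1 / k := by
  have hr : 0 < r := (mul_nonneg hk.le hμ).trans_lt h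
  refine ⟨hr, div_nonneg hμ hr.le, ?_⟩
  rw [div_lt_div_iff₀ hr hk]
  linarith

variable {S : Potentials} {μ T : ℝ} {Ne : Triple} {y : ℝ → Event}

theorem covTangent_metric_zero (I : Set ℝ) (σ : ℝ) :
    covTangent (S.metric μ) I y σ 0 =
      powerSum S.a (μ / ‖spatial (y σ)‖) * tangent I y σ 0 := by
  have := Matrix.mulVec_diagonal
    (Fin.cons (S.A μ ‖spatial (y σ)‖) (fun _ : Fin 3 => -S.invB μ ‖spatial (y σ)‖) : Fin 4 → ℝ)
    (tangent I y σ) 0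
  exact this

theorem covTangent_metric_succ (I : Set ℝ) (σ : ℝ) (i : Fin 3) :
    covTangent (S.metric μ) I y σ i.succ =
      -powerSum S.c (μ / ‖spatial (y σ)‖) * tangent I y σ i.succ := by
  have := Matrix.mulVec_diagonal
    (Fin.cons (S.A μ ‖spatial (y σ)‖) (fun _ : Fin 3 => -S.invB μ ‖spatial (y σ)‖) : Fin 4 → ℝ)
    (tangent I y σ) i.succ
  exact this

/-- The metric is diagonal and depends on the event only through r, so every derivative carries the
common factor `L e`. In the time direction this factor is zero, which is the conservation of l₀. -/
theorem sum_fderiv_metric {z v e : Event} (hμ : 0 ≤ μ) (hz : S.k * μ < ‖spatial z‖)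
    {L : Event →L[ℝ] ℝ} (hL : HasFDerivAt (fun z => ‖spatial z‖) L z) :
    ∑ i, ∑ j, fderiv ℝ (fun y => S.metric μ y i j) z e * v i * v j =
      (-μ / ‖spatial z‖ ^ 2) * (deriv (powerSum S.a) (μ / ‖spatial z‖) * v 0 ^ 2
        - deriv (powerSum S.c) (μ / ‖spatial z‖) * ‖spatial v‖ ^ 2) * L e := by
  obtain ⟨hr, hu0, hu1⟩ := div_lt_inv_of_outside S.k_pos hμ hz
  have hoff : ∀ i j : Fin 4, i ≠ j → fderiv ℝ (fun y => S.metric μ y i j) z e = 0 := by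
    intro i j hij
    have : (fun y => S.metric μ y i j) = fun _ => (0 : ℝ) := by
      funext y
      exact Matrix.diagonal_apply_ne _ hij
    rw [this]; simp
  have h0 : fderiv ℝ (fun y => S.metric μ y 0 0) z e =
      deriv (powerSum S.a) (μ / ‖spatial z‖) * (-μ / ‖spatial z‖ ^ 2) * L e := by
    have h := (hasDerivAt_powerSum_div hr (S.analyticAt_a hu0 hu1)).comp_hasFDerivAt z hL
    have e1 : (fun y => S.metric μ y 0 0) =
        (fun s => powerSum S.a (μ / s)) ∘ fun z => ‖spatial z‖ := by
      funext y
      exact Matrix.diagonal_apply_eq _ _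
    rw [e1, h.fderiv]; simp
  have hs : ∀ i : Fin 3, fderiv ℝ (fun y => S.metric μ y i.succ i.succ) z e =
      -(deriv (powerSum S.c) (μ / ‖spatial z‖) * (-μ / ‖spatial z‖ ^ 2) * L e) := by
    intro i
    have h := ((hasDerivAt_powerSum_div hr (S.analyticAt_c hu0 hu1)).comp_hasFDerivAt z hL).neg
    have e1 : (fun y => S.metric μ y i.succ i.succ) =
        -((fun s => powerSum S.c (μ / s)) ∘ fun z => ‖spatial z‖) := by
      funext y
      exact Matrix.diagonal_apply_eq _ _
    rw [e1, h.fderiv]; simp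
  have hdiag : ∀ i : Fin 4, ∑ j, fderiv ℝ (fun y => S.metric μ y i j) z e * v i * v j =
      fderiv ℝ (fun y => S.metric μ y i i) z e * v i ^ 2 := by
    intro i
    rw [Finset.sum_eq_single i]
    · ring
    · intro j _ hj
      rw [hoff i j hj.symm]; ring
    · simp
  simp only [hdiag]
  rw [Fin.sum_univ_succ, h0, norm_spatial_sq v]
  simp only [hs]
  rw [← Finset.mul_sum]
  ring

/-- A null geodesic coming from infinity is a ray of the optical medium of the metric. -/
theorem isRay_of_isNullGeodesicOn (hμ : 0 ≤ μ)
    (hgeo : IsNullGeodesicOn (S.metric μ) (Set.Iic T) y)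
    (hout : ∀ σ ≤ T, S.rh μ < ‖spatial (y σ)‖) (hinf : EmittedAtInfinity Ne T y) :
    ∃ w : ℝ → ℝ, IsRay S μ Ne T (fun σ => spatial (y σ))
      (fun σ => -directionTriple (S.metric μ) (Set.Iic T) y σ) w (fun σ => y σ 0) := by
  set v : ℝ → Event := tangent (Set.Iic T) y with hv
  set r : ℝ → ℝ := fun σ => ‖spatial (y σ)‖ with hr
  set p : ℝ → Triple := fun σ => -directionTriple (S.metric μ) (Set.Iic T) y σ with hp
  have hout' : ∀ σ ≤ T, S.k * μ < r σ := hout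
  have hbd := fun σ hσ => div_lt_inv_of_outside S.k_pos hμ (hout' σ hσ)
  have ha := fun σ hσ => S.powerSum_a_pos (hbd σ hσ).2.1 (hbd σ hσ).2.2
  have hc := fun σ hσ => S.powerSum_c_pos (hbd σ hσ).2.1 (hbd σ hσ).2.2
  have hv0 : ∀ σ ≤ T, 0 < v σ 0 := hgeo.future
  have hp_apply : ∀ σ i, p σ i = powerSum S.c (μ / r σ) * v σ i.succ /
      (powerSum S.a (μ / r σ) * v σ 0) := by
    intro σ i
    simp only [hp, directionTriple, PiLp.neg_apply, covTangent_metric_zero,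
      covTangent_metric_succ]
    ring
  have hp_smul : ∀ σ, p σ = S.index (μ / r σ) • ((v σ 0)⁻¹ • spatial (v σ)) := by
    intro σ
    ext i
    rw [hp_apply]
    simp only [PiLp.smul_apply, spatial_apply, smul_eq_mul, Potentials.index]
    rw [div_eq_mul_inv, mul_inv]
    ring
  have hnull : ∀ σ ≤ T, powerSum S.a (μ / r σ) * v σ 0 ^ 2 =
      powerSum S.c (μ / r σ) * ‖spatial (v σ)‖ ^ 2 := by
    intro σ hσ
    have h := hgeo.null σ hσ
    rw [Fin.sum_univ_succ, covTangent_metric_zero] at h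
    simp only [covTangent_metric_succ] at h
    rw [norm_spatial_sq, Finset.mul_sum]
    have h' : ∑ i : Fin 3, powerSum S.c (μ / r σ) * v σ i.succ ^ 2 =
        -∑ i : Fin 3, -powerSum S.c (μ / ‖spatial (y σ)‖) * tangent (Set.Iic T) y σ i.succ *
          tangent (Set.Iic T) y σ i.succ := by
      rw [← Finset.sum_neg_distrib]
      exact Finset.sum_congr rfl fun i _ => by ring
    rw [h']
    linear_combination h
  have hy : ∀ σ ≤ T, ∀ α, HasDerivWithinAt (fun s => y s α) (v σ α) (Set.Iic T) σ := by
    intro σ hσ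
    exact hasDerivWithinAt_pi.1 (hgeo.differentiable σ hσ).hasDerivWithinAt
  -- The factor is forced by p = N v/v⁰ and x' = w p.
  refine ⟨fun σ => powerSum S.a (μ / r σ) * v σ 0 / powerSum S.c (μ / r σ), ?_⟩
  refine ⟨hout', fun σ hσ => div_pos (mul_pos (ha σ hσ) (hv0 σ hσ)) (hc σ hσ), ?_, ?_, ?_, ?_,
    hinf.1, ?_⟩
  · intro σ hσ
    rw [hasDerivWithinAt_triple]
    intro i
    refine (hy σ hσ i.succ).congr_deriv ?_
    rw [PiLp.smul_apply, smul_eq_mul, hp_apply]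
    have := (ha σ hσ).ne'
    have := (hc σ hσ).ne'
    have := (hv0 σ hσ).ne'
    field_simp
  · intro σ hσ
    rw [hasDerivWithinAt_triple]
    intro i
    obtain ⟨L, hL, hL0, hLs⟩ := hasFDerivAt_norm_spatial (hbd σ hσ).1
    have g0 := hgeo.geodesic σ hσ 0
    have gi := hgeo.geodesic σ hσ i.succ
    rw [sum_fderiv_metric hμ (hout' σ hσ) hL, hL0] at g0
    rw [sum_fderiv_metric hμ (hout' σ hσ) hL, hLs] at gi
    have hl0 : covTangent (S.metric μ) (Set.Iic T) y σ 0 ≠ 0 := by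
      rw [covTangent_metric_zero]
      exact (mul_pos (ha σ hσ) (hv0 σ hσ)).ne'
    refine ((gi.div g0 hl0).neg).congr_deriv ?_
    rw [covTangent_metric_zero, PiLp.smul_apply, smul_eq_mul, spatial_apply,
      S.deriv_index (hbd σ hσ).2.1 (hbd σ hσ).2.2]
    have h1 := (ha σ hσ).ne'
    have h2 := (hc σ hσ).ne'
    have h3 := (hv0 σ hσ).ne'
    have h4 := (hbd σ hσ).1.ne'
    have hn := hnull σ hσ
    -- Eliminating the spatial speed by the null condition combines the derivatives of the two
    -- potentials into the derivative of their quotient.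
    have hsq : ‖spatial (v σ)‖ ^ 2 = powerSum S.a (μ / r σ) * v σ 0 ^ 2 /
        powerSum S.c (μ / r σ) := by
      rw [hn]; field_simp
    simp only [hr, hv] at *
    rw [hsq]
    field_simp
    ring
  · intro σ hσ
    refine (hy σ hσ 0).congr_deriv ?_
    have := (ha σ hσ).ne'
    have := (hc σ hσ).ne'
    simp only [Potentials.index, hr] at *
    field_simp
  · intro σ hσ
    have h1 := (ha σ hσ).ne'
    have h2 := (hc σ hσ).ne'
    have h3 := (hv0 σ hσ).ne'
    rw [hp_smul, norm_smul, norm_smul, mul_pow, mul_pow, norm_inv, Real.norm_eq_abs,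
      Real.norm_eq_abs, inv_pow, sq_abs, sq_abs]
    have hn := hnull σ hσ
    have hsq : ‖spatial (v σ)‖ ^ 2 = powerSum S.a (μ / r σ) * v σ 0 ^ 2 /
        powerSum S.c (μ / r σ) := by
      rw [hn]; field_simp
    rw [hsq]
    simp only [Potentials.index, hr] at *
    field_simp
  · have hlim : Tendsto (fun σ => S.index (μ / r σ)) atBot (𝓝 1) := by
      have h0 : Tendsto (fun σ => μ / r σ) atBot (𝓝 0) := hinf.1.const_div_atTop μ
      have := (S.analyticAt_index le_rfl S.inv_k_pos).continuousAt.tendsto.comp h0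
      rwa [S.index_zero] at this
    have := hlim.smul hinf.2
    rw [one_smul] at this
    refine this.congr fun σ => ?_
    exact (hp_smul σ).symm

/-! ### Plane rays: side of the centre and second order expansion -/

/-- A ray in the plane, in Cartesian coordinates `z` (along the incoming direction) and `y`, with
angular momentum `b`. -/
structure IsPlaneRay (S : Potentials) (m b T : ℝ) (z y pz py w r : ℝ → ℝ) : Prop where
  w_pos : ∀ σ ≤ T, 0 < w σ
  r_pos : ∀ σ ≤ T, 0 < r σ
  r_sq : ∀ σ ≤ T, r σ ^ 2 = z σ ^ 2 + y σ ^ 2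
  deriv_z : ∀ σ ≤ T, HasDerivWithinAt z (w σ * pz σ) (Set.Iic T) σ
  deriv_y : ∀ σ ≤ T, HasDerivWithinAt y (w σ * py σ) (Set.Iic T) σ
  deriv_pz : ∀ σ ≤ T, HasDerivWithinAt pz
    (-(w σ * m / (2 * r σ ^ 3) * deriv S.index (m / r σ)) * z σ) (Set.Iic T) σ
  deriv_py : ∀ σ ≤ T, HasDerivWithinAt py
    (-(w σ * m / (2 * r σ ^ 3) * deriv S.index (m / r σ)) * y σ) (Set.Iic T) σ
  angular : ∀ σ ≤ T, y σ * pz σ - z σ * py σ = b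
  tendsto_r : Tendsto r atBot atTop
  tendsto_pz : Tendsto pz atBot (𝓝 1)
  tendsto_py : Tendsto py atBot (𝓝 0)

namespace IsPlaneRay

variable {S : Potentials} {m b T : ℝ} {z y pz py w r : ℝ → ℝ}

theorem z_lt (h : IsPlaneRay S m b T z y pz py w r) (hpz : ∀ σ ≤ T, 1 / 2 ≤ pz σ) {a c : ℝ}
    (hac : a < c) (hc : c ≤ T) : z a < z c :=
  lt_of_deriv_pos hac hc (fun σ _ h2 => h.deriv_z σ (h2.trans hc)) fun σ _ h2 =>
    mul_pos (h.w_pos σ (h2.le.trans hc)) (by linarith [hpz σ (h2.le.trans hc)])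

/-- Angular momentum gives |y| ≤ 2b + |z|, so r → ∞ forces |z| → ∞; monotonicity of z excludes the
limit +∞. -/
theorem tendsto_z (h : IsPlaneRay S m b T z y pz py w r) (hb : 0 < b)
    (hpz : ∀ σ ≤ T, 1 / 2 ≤ pz σ) (hpy : ∀ σ ≤ T, |py σ| ≤ 1 / 2) : Tendsto z atBot atBot := by
  rw [tendsto_atBot]
  intro M
  filter_upwards [h.tendsto_r.eventually_ge_atTop (2 * (|M| + |z T|) + 2 * b + 1),
    eventually_lt_atBot T] with σ hr hσ
  have hlt := h.z_lt hpz hσ le_rfl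
  have h1 := hpz σ hσ.le
  have h2 := hpy σ hσ.le
  have hang := h.angular σ hσ.le
  have hy : |y σ| ≤ 2 * b + |z σ| := by
    have e1 : |y σ| * pz σ = |b + z σ * py σ| := by
      rw [← abs_of_nonneg (by linarith : 0 ≤ pz σ), ← abs_mul]
      congr 1
      linarith
    have e2 : |b + z σ * py σ| ≤ b + |z σ| * (1 / 2) := by
      refine (abs_add_le _ _).trans ?_
      rw [abs_of_pos hb, abs_mul]
      have := mul_le_mul_of_nonneg_left h2 (abs_nonneg (z σ))
      linarith
    nlinarith [abs_nonneg (y σ)]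
  have hrle : r σ ≤ |z σ| + |y σ| := by
    apply le_of_sq_le_sq _ (by positivity)
    rw [h.r_sq σ hσ.le]
    nlinarith [sq_abs (z σ), sq_abs (y σ), abs_nonneg (z σ), abs_nonneg (y σ),
      mul_nonneg (abs_nonneg (z σ)) (abs_nonneg (y σ))]
  have hzabs : |M| + |z T| < |z σ| := by linarith
  rcases abs_cases (z σ) with ⟨e, _⟩ | ⟨e, _⟩
  · linarith [le_abs_self (z T), abs_nonneg M]
  · linarith [neg_abs_le M, abs_nonneg (z T)]

/-- Dividing the angular momentum identity by z pz gives y/z = (b/z + py)/pz. -/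
theorem tendsto_slope (h : IsPlaneRay S m b T z y pz py w r)
    (hz : Tendsto z atBot atBot) : Tendsto (fun σ => y σ / z σ) atBot (𝓝 0) := by
  have h1 : Tendsto (fun σ => (b / z σ + py σ) / pz σ) atBot (𝓝 ((0 + 0) / 1)) :=
    ((hz.const_div_atBot b).add h.tendsto_py).div h.tendsto_pz one_ne_zero
  rw [add_zero, zero_div] at h1
  refine h1.congr' ?_
  filter_upwards [hz.eventually_lt_atBot 0, eventually_le_atBot T,
    h.tendsto_pz.eventually (lt_mem_nhds one_pos)] with σ hzσ hσ hpσ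
  have := h.angular σ hσ
  have h2 := hzσ.ne
  have h3 := hpσ.ne'
  field_simp
  linarith

/-- A ray that does not cross the axis through the centre before its end stays on one side. -/
theorem y_pos (h : IsPlaneRay S m b T z y pz py w r) (hb : 0 < b)
    (hpz : ∀ σ ≤ T, 1 / 2 ≤ pz σ) (hz : Tendsto z atBot atBot)
    (hend : z T < 0 ∨ 0 < y T) : ∀ σ ≤ T, 0 < y σ := by
  have hneg : ∀ σ ≤ T, z σ < 0 → 0 < y σ := by
    intro σ hσ hzσ
    have hz' : ∀ a ≤ σ, z a < 0 := fun a ha => by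
      rcases ha.eq_or_lt with rfl | ha
      · exact hzσ
      · exact (h.z_lt hpz ha hσ).trans hzσ
    have hmono : ∀ a c, a < c → c ≤ σ → -(y a / z a) < -(y c / z c) := by
      intro a c hac hc
      refine lt_of_deriv_pos (f := fun σ => -(y σ / z σ)) (f' := fun σ => w σ * b / z σ ^ 2) hac
        (hc.trans hσ) (fun s _ hs => ?_) (fun s _ hs => ?_)
      · have hsT : s ≤ T := hs.trans (hc.trans hσ)
        refine (((h.deriv_y s hsT).div (h.deriv_z s hsT)
          (hz' s (hs.trans hc)).ne).neg).congr_deriv ?_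
        rw [← h.angular s hsT]
        ring
      · have hsT : s ≤ T := hs.le.trans (hc.trans hσ)
        have := (hz' s (hs.le.trans hc)).ne
        have := h.w_pos s hsT
        positivity
    have hlim : Tendsto (fun σ => -(y σ / z σ)) atBot (𝓝 0) := by
      simpa using (h.tendsto_slope hz).neg
    have h0 : 0 ≤ -(y (σ - 1) / z (σ - 1)) := by
      refine le_of_tendsto hlim ?_
      filter_upwards [eventually_lt_atBot (σ - 1)] with a ha
      exact (hmono a _ ha (by linarith)).le
    have h1 : 0 < -(y σ / z σ) := h0.trans_lt (hmono _ _ (by linarith) le_rfl)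
    by_contra hy
    have : 0 ≤ y σ / z σ := div_nonneg_of_nonpos (not_lt.1 hy) hzσ.le
    linarith
  intro σ hσ
  rcases lt_trichotomy (z σ) 0 with hzσ | hzσ | hzσ
  · exact hneg σ hσ hzσ
  · have := h.angular σ hσ
    rw [hzσ, zero_mul, sub_zero] at this
    by_contra hy
    nlinarith [hpz σ hσ]
  · have hzT : 0 < z T := by
      rcases hσ.eq_or_lt with rfl | hlt
      · exact hzσ
      · exact hzσ.trans (h.z_lt hpz hlt le_rfl)
    -- Beyond z = 0 the same monotonicity is used backwards from the end, whose side is given.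
    have hyT : 0 < y T := hend.resolve_left (not_lt.2 hzT.le)
    rcases hσ.eq_or_lt with rfl | hlt
    · exact hyT
    have hz' : ∀ a, σ ≤ a → a ≤ T → 0 < z a := fun a ha haT => by
      rcases ha.eq_or_lt with rfl | ha
      · exact hzσ
      · exact hzσ.trans (h.z_lt hpz ha haT)
    have : -(y σ / z σ) < -(y T / z T) := by
      refine lt_of_deriv_pos (f := fun σ => -(y σ / z σ)) (f' := fun σ => w σ * b / z σ ^ 2) hlt
        le_rfl (fun s hs1 hs => ?_) (fun s hs1 hs => ?_)
      · refine (((h.deriv_y s hs).div (h.deriv_z s hs) (hz' s hs1 hs).ne').neg).congr_deriv ?_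
        rw [← h.angular s hs]
        ring
      · have := hz' s hs1.le hs.le
        have := h.w_pos s hs.le
        positivity
    have h2 : 0 < y T / z T := div_pos hyT hzT
    have h3 : 0 < y σ / z σ := by linarith
    exact (div_pos_iff_of_pos_right hzσ).1 h3

theorem deriv_r (h : IsPlaneRay S m b T z y pz py w r) {σ : ℝ} (hσ : σ ≤ T) :
    HasDerivWithinAt r (w σ * (z σ * pz σ + y σ * py σ) / r σ) (Set.Iic T) σ := by
  have hrσ := h.r_pos σ hσ
  have e : ∀ s ≤ T, r s = √(z s ^ 2 + y s ^ 2) := fun s hs => by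
    rw [← h.r_sq s hs, Real.sqrt_sq (h.r_pos s hs).le]
  have h1 := ((h.deriv_z σ hσ).pow 2).add ((h.deriv_y σ hσ).pow 2)
  have h2 : HasDerivWithinAt (fun s => √(z s ^ 2 + y s ^ 2)) _ _ _ := h1.sqrt (by
    simp only [Pi.add_apply, Pi.pow_apply]
    rw [← h.r_sq σ hσ]; positivity)
  refine (h2.congr (fun s hs => e s hs) (e σ hσ)).congr_deriv ?_
  simp only [Pi.add_apply, Pi.pow_apply]
  rw [← e σ hσ]
  field_simp
  ring

theorem deriv_cos (h : IsPlaneRay S m b T z y pz py w r) {σ : ℝ} (hσ : σ ≤ T) :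
    HasDerivWithinAt (fun s => z s / r s) (w σ * y σ * b / r σ ^ 3) (Set.Iic T) σ := by
  have hrσ := h.r_pos σ hσ
  refine ((h.deriv_z σ hσ).div (h.deriv_r hσ) hrσ.ne').congr_deriv ?_
  rw [← h.angular σ hσ]
  field_simp
  rw [h.r_sq σ hσ]
  ring

theorem deriv_sin (h : IsPlaneRay S m b T z y pz py w r) {σ : ℝ} (hσ : σ ≤ T) :
    HasDerivWithinAt (fun s => y s / r s) (-(w σ * z σ * b / r σ ^ 3)) (Set.Iic T) σ := by
  have hrσ := h.r_pos σ hσ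
  refine ((h.deriv_y σ hσ).div (h.deriv_r hσ) hrσ.ne').congr_deriv ?_
  rw [← h.angular σ hσ]
  field_simp
  rw [h.r_sq σ hσ]
  ring

theorem deriv_angle (h : IsPlaneRay S m b T z y pz py w r) {σ : ℝ} (hσ : σ ≤ T)
    (hy : 0 < y σ) :
    HasDerivWithinAt (fun s => Real.pi - Real.arccos (z s / r s)) (w σ * b / r σ ^ 2)
      (Set.Iic T) σ := by
  have hrσ := h.r_pos σ hσ
  have hsq := h.r_sq σ hσ
  have hone : (z σ / r σ) ^ 2 + (y σ / r σ) ^ 2 = 1 := by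
    field_simp; linarith
  have hypos : 0 < y σ / r σ := div_pos hy hrσ
  have hlt : (z σ / r σ) ^ 2 < 1 := by nlinarith
  have h1 : z σ / r σ ≠ -1 := fun e => by rw [e] at hlt; norm_num at hlt
  have h2 : z σ / r σ ≠ 1 := fun e => by rw [e] at hlt; norm_num at hlt
  have hsqrt : √(1 - (z σ / r σ) ^ 2) = y σ / r σ := by
    rw [show 1 - (z σ / r σ) ^ 2 = (y σ / r σ) ^ 2 by linarith, Real.sqrt_sq hypos.le]
  refine (((Real.hasDerivAt_arccos h1 h2).comp_hasDerivWithinAt σ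
    (h.deriv_cos hσ)).const_sub Real.pi).congr_deriv ?_
  rw [hsqrt]
  field_simp

/-- The second order expansion of the direction of a ray. -/
theorem direction_expansion (h : IsPlaneRay S m b T z y pz py w r) (hm : 0 < m) (hb : 0 < b)
    {B K : ℝ} (hK : 0 ≤ K) (hypos : ∀ σ ≤ T, 0 < y σ) (hz : Tendsto z atBot atBot)
    (hpz : ∀ σ ≤ T, |pz σ - 1| ≤ B * (m / b)) (hpy : ∀ σ ≤ T, |py σ| ≤ B * (m / b))
    (hbr : ∀ σ ≤ T, b ≤ 2 * r σ)
    (hindex : ∀ σ ≤ T, |deriv S.index (m / r σ) - (2 * (1 + S.γ) + 4 * S.κ * (m / r σ))| ≤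
      K * (m / r σ) ^ 2) :
    ∀ σ ≤ T,
      |pz σ - (1 + m * (y σ / r σ) / b * (1 + S.γ + S.κ * m * (y σ / r σ) / b))| ≤
        (2 * K + 4 * |S.κ| * B) * Real.pi * (m / b) ^ 3 ∧
      |py σ + m / b * ((1 + S.γ) * (1 + z σ / r σ) + S.κ * m / b *
        (Real.pi - Real.arccos (z σ / r σ) + y σ / r σ * (z σ / r σ)))| ≤
        (2 * K + 4 * |S.κ| * B) * Real.pi * (m / b) ^ 3 := by
  set δ := m / b with hδ
  have hδpos : 0 < δ := div_pos hm hb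
  have hmb : m = δ * b := by rw [hδ]; field_simp
  set C₁ := 2 * K + 4 * |S.κ| * B with hC₁
  set s : ℝ → ℝ := fun σ => y σ / r σ with hs
  set c : ℝ → ℝ := fun σ => z σ / r σ with hc
  have hone : ∀ σ ≤ T, c σ ^ 2 + s σ ^ 2 = 1 := by
    intro σ hσ
    have h1 := h.r_sq σ hσ
    have h2 := h.r_pos σ hσ
    simp only [hs, hc]
    field_simp; linarith
  have hsabs : ∀ σ ≤ T, |s σ| ≤ 1 := fun σ hσ =>
    abs_le_one_iff_mul_self_le_one.2 (by nlinarith [hone σ hσ, sq_nonneg (c σ)])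
  have hcabs : ∀ σ ≤ T, |c σ| ≤ 1 := fun σ hσ =>
    abs_le_one_iff_mul_self_le_one.2 (by nlinarith [hone σ hσ, sq_nonneg (s σ)])
  -- This is the error of the linear model of N'/2 after b/r has been replaced by y/r. Both
  -- differences to be estimated will have derivative ω δ e times a factor of modulus at most 1.
  set e : ℝ → ℝ := fun σ => deriv S.index (m / r σ) / 2 - (1 + S.γ) - 2 * S.κ * δ * s σ with he
  have hebd : ∀ σ ≤ T, |e σ| ≤ C₁ * δ ^ 2 := by
    intro σ hσ
    have hr := h.r_pos σ hσ
    have hu : m / r σ = δ * (b / r σ) := by rw [hmb]; ring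
    have hbr' : b / r σ ≤ 2 := by rw [div_le_iff₀ hr]; exact hbr σ hσ
    have hbr0 : 0 < b / r σ := div_pos hb hr
    have hu2 : m / r σ ≤ 2 * δ := by rw [hu]; nlinarith
    have hu0 : 0 ≤ m / r σ := by positivity
    have hdiff : |b / r σ - s σ| ≤ 2 * (B * δ) := by
      -- Angular momentum b = y pz - z py divided by r: the replacement costs only the deflection.
      have e1 : b / r σ - s σ = s σ * (pz σ - 1) - c σ * py σ := by
        rw [← h.angular σ hσ]
        simp only [hs, hc]
        field_simp
        ring
      rw [e1]
      have t1 : |s σ * (pz σ - 1)| ≤ 1 * (B * δ) := by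
        rw [abs_mul]
        exact mul_le_mul (hsabs σ hσ) (hpz σ hσ) (abs_nonneg _) one_pos.le
      have t2 : |c σ * py σ| ≤ 1 * (B * δ) := by
        rw [abs_mul]
        exact mul_le_mul (hcabs σ hσ) (hpy σ hσ) (abs_nonneg _) one_pos.le
      exact (abs_sub _ _).trans (by linarith)
    have e2 : e σ = (deriv S.index (m / r σ) - (2 * (1 + S.γ) + 4 * S.κ * (m / r σ))) / 2
        + 2 * S.κ * (δ * (b / r σ - s σ)) := by
      simp only [he]
      rw [hu]; ring
    rw [e2]
    have t1 : |(deriv S.index (m / r σ) - (2 * (1 + S.γ) + 4 * S.κ * (m / r σ))) / 2| ≤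
        2 * K * δ ^ 2 := by
      rw [abs_div, abs_two]
      have := hindex σ hσ
      have h4 : (m / r σ) ^ 2 ≤ 4 * δ ^ 2 := by nlinarith
      have := mul_le_mul_of_nonneg_left h4 hK
      linarith
    have t2 : |2 * S.κ * (δ * (b / r σ - s σ))| ≤ 4 * |S.κ| * B * δ ^ 2 := by
      rw [abs_mul, abs_mul, abs_two, abs_mul, abs_of_pos hδpos]
      have := mul_le_mul_of_nonneg_left hdiff (by positivity : 0 ≤ 2 * |S.κ| * δ)
      linarith
    refine (abs_add_le _ _).trans ?_
    rw [hC₁]; linarith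
  have hsinlim : Tendsto s atBot (𝓝 0) := by
    refine squeeze_zero_norm' ?_ (tendsto_zero_iff_norm_tendsto_zero.1 (h.tendsto_slope hz))
    filter_upwards [hz.eventually_lt_atBot 0, eventually_le_atBot T] with σ hzσ hσ
    have hr := h.r_pos σ hσ
    simp only [hs, norm_div]
    refine div_le_div_of_nonneg_left (norm_nonneg _) (norm_pos_iff.2 hzσ.ne) ?_
    rw [Real.norm_eq_abs, Real.norm_eq_abs, abs_of_pos hr]
    exact abs_le_of_sq_le_sq (by nlinarith [h.r_sq σ hσ, sq_nonneg (y σ)]) hr.le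
  have hcoslim : Tendsto c atBot (𝓝 (-1)) := by
    have h0 : Tendsto (fun σ => c σ + 1) atBot (𝓝 0) := by
      refine squeeze_zero_norm' ?_ (by simpa using hsinlim.pow 2)
      filter_upwards [hz.eventually_lt_atBot 0, eventually_le_atBot T] with σ hzσ hσ
      have hr := h.r_pos σ hσ
      have hc0 : c σ < 0 := div_neg_of_neg_of_pos hzσ hr
      have h1 := hone σ hσ
      have h2 := abs_le.1 (hcabs σ hσ)
      rw [Real.norm_eq_abs, abs_of_nonneg (by linarith)]
      nlinarith
    simpa using h0.sub_const 1
  -- The majorant is a multiple of the polar angle, which starts at 0 and is at most π; this is the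
  -- source of the factor π.
  have hanglelim : Tendsto (fun σ => C₁ * δ ^ 3 * (Real.pi - Real.arccos (c σ))) atBot (𝓝 0) := by
    have := ((Real.continuous_arccos.tendsto (-1)).comp hcoslim).const_sub Real.pi
    rw [Real.arccos_neg_one, sub_self] at this
    simpa using this.const_mul (C₁ * δ ^ 3)
  have hangle : ∀ σ ≤ T, HasDerivWithinAt
      (fun σ => C₁ * δ ^ 3 * (Real.pi - Real.arccos (c σ)))
      (C₁ * δ ^ 3 * (w σ * b / r σ ^ 2)) (Set.Iic T) σ := fun σ hσ =>
    (h.deriv_angle hσ (hypos σ hσ)).const_mul _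
  have hrate : ∀ σ ≤ T, 0 < w σ * b / r σ ^ 2 := fun σ hσ => by
    have := h.w_pos σ hσ
    have := h.r_pos σ hσ
    positivity
  have hC₁nonneg : ∀ σ ≤ T, 0 ≤ C₁ * δ ^ 3 := fun σ hσ => by
    have := (abs_nonneg _).trans (hebd σ hσ)
    nlinarith
  have hfinal : ∀ σ ≤ T, C₁ * δ ^ 3 * (Real.pi - Real.arccos (c σ)) - 0 ≤
      C₁ * Real.pi * δ ^ 3 := fun σ hσ => by
    have := mul_nonneg (hC₁nonneg σ hσ) (Real.arccos_nonneg (c σ))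
    linarith
  have hbound : ∀ σ ≤ T, ∀ t : ℝ, |t| ≤ 1 → ‖w σ * b / r σ ^ 2 * δ * t * e σ‖ ≤
      C₁ * δ ^ 3 * (w σ * b / r σ ^ 2) := by
    intro σ hσ t ht
    rw [Real.norm_eq_abs, abs_mul, abs_mul, abs_mul, abs_of_pos (hrate σ hσ), abs_of_pos hδpos]
    have h1 : |t| * |e σ| ≤ 1 * (C₁ * δ ^ 2) :=
      mul_le_mul ht (hebd σ hσ) (abs_nonneg _) one_pos.le
    have := mul_le_mul_of_nonneg_left h1 (mul_pos (hrate σ hσ) hδpos).le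
    calc _ = w σ * b / r σ ^ 2 * δ * (|t| * |e σ|) := by ring
      _ ≤ _ := this
      _ = _ := by ring
  intro σ hσ
  constructor
  · have hlim : Tendsto (fun σ => pz σ - (1 + m * s σ / b * (1 + S.γ + S.κ * m * s σ / b))) atBot
        (𝓝 0) := by
      have h1 : Tendsto (fun σ => 1 + m * s σ / b * (1 + S.γ + S.κ * m * s σ / b)) atBot
          (𝓝 (1 + m * 0 / b * (1 + S.γ + S.κ * m * 0 / b))) :=
        (((hsinlim.const_mul m).div_const b).mul
          (((hsinlim.const_mul (S.κ * m)).div_const b).const_add _)).const_add 1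
      simpa using h.tendsto_pz.sub h1
    have hder : ∀ σ ≤ T, HasDerivWithinAt
        (fun σ => pz σ - (1 + m * s σ / b * (1 + S.γ + S.κ * m * s σ / b)))
        (w σ * b / r σ ^ 2 * δ * (-c σ) * e σ) (Set.Iic T) σ := by
      intro σ hσ
      have hr := h.r_pos σ hσ
      have hsd := h.deriv_sin hσ
      refine ((h.deriv_pz σ hσ).sub ((((hsd.const_mul m).div_const b).mul
        (((hsd.const_mul (S.κ * m)).div_const b).const_add (1 + S.γ))).const_add
        1)).congr_deriv ?_
      simp only [he, hs, hc, hδ]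
      field_simp
      ring
    have := norm_sub_le_sub_of_tendsto_atBot hσ (fun σ' h' => hder σ' (h'.trans hσ))
      (fun σ' h' => hangle σ' (h'.trans hσ))
      (fun σ' h' => hbound σ' (h'.le.trans hσ) _ (by
        rw [abs_neg]; exact hcabs σ' (h'.le.trans hσ))) hlim hanglelim
    rw [sub_zero, Real.norm_eq_abs] at this
    exact this.trans (hfinal σ hσ)
  · have hlim : Tendsto (fun σ => py σ + m / b * ((1 + S.γ) * (1 + c σ) + S.κ * m / b *
        (Real.pi - Real.arccos (c σ) + s σ * c σ))) atBot (𝓝 0) := by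
      have h0 := ((Real.continuous_arccos.tendsto (-1)).comp hcoslim).const_sub Real.pi
      rw [Real.arccos_neg_one, sub_self] at h0
      have h1 := h.tendsto_py.add ((((hcoslim.const_add 1).const_mul (1 + S.γ)).add
        ((h0.add (hsinlim.mul hcoslim)).const_mul (S.κ * m / b))).const_mul (m / b))
      simpa using h1
    have hder : ∀ σ ≤ T, HasDerivWithinAt
        (fun σ => py σ + m / b * ((1 + S.γ) * (1 + c σ) + S.κ * m / b *
          (Real.pi - Real.arccos (c σ) + s σ * c σ)))
        (w σ * b / r σ ^ 2 * δ * (-s σ) * e σ) (Set.Iic T) σ := by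
      intro σ hσ
      have hr := h.r_pos σ hσ
      have hsd := h.deriv_sin hσ
      have hcd := h.deriv_cos hσ
      have had := h.deriv_angle hσ (hypos σ hσ)
      refine ((h.deriv_py σ hσ).add ((((hcd.const_add 1).const_mul (1 + S.γ)).add
        ((had.add (hsd.mul hcd)).const_mul (S.κ * m / b))).const_mul (m / b))).congr_deriv ?_
      -- With c' = ω s, s' = -ω c and φ' = ω, the bracket φ + sc has derivative ω(1 - c² + s²) = 2ω
      -- s², matching the κ term of the force.
      have hsq := h.r_sq σ hσ
      have hz2 : z σ ^ 2 = r σ ^ 2 - y σ ^ 2 := by linarith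
      simp only [he, hs, hδ]
      field_simp
      ring_nf
      rw [hz2]
      ring
    have := norm_sub_le_sub_of_tendsto_atBot hσ (fun σ' h' => hder σ' (h'.trans hσ))
      (fun σ' h' => hangle σ' (h'.trans hσ))
      (fun σ' h' => hbound σ' (h'.le.trans hσ) _ (by
        rw [abs_neg]; exact hsabs σ' (h'.le.trans hσ))) hlim hanglelim
    rw [sub_zero, Real.norm_eq_abs] at this
    exact this.trans (hfinal σ hσ)

end IsPlaneRay
-- Rays in space: conservation laws and a priori bounds
/-- A linear combination identity for the rate of turning about the direction of `X`. -/
theorem inner_cross_mul_sub (x p X W : Triple) :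
    (inner ℝ (cross p X) W * inner ℝ x X - inner ℝ (cross x X) W * inner ℝ p X : ℝ) =
      inner ℝ X (cross x p) * inner ℝ X W - inner ℝ X X * inner ℝ (cross x p) W := by
  simp only [inner_triple, cross_apply_zero, cross_apply_one, cross_apply_two]
  ring

namespace IsRay

variable {S : Potentials} {μ T : ℝ} {Ne : Triple} {x p : ℝ → Triple} {w τ : ℝ → ℝ}

theorem norm_pos (h : IsRay S μ Ne T x p w τ) (hμ : 0 ≤ μ) {σ : ℝ} (hσ : σ ≤ T) : 0 < ‖x σ‖ :=
  (div_lt_inv_of_outside S.k_pos hμ (h.outside σ hσ)).1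

theorem index_pos (h : IsRay S μ Ne T x p w τ) (hμ : 0 ≤ μ) {σ : ℝ} (hσ : σ ≤ T) :
    0 < S.index (μ / ‖x σ‖) :=
  have hb := div_lt_inv_of_outside S.k_pos hμ (h.outside σ hσ)
  S.index_pos hb.2.1 hb.2.2

/-- Conservation of angular momentum. -/
theorem cross_eq (h : IsRay S μ Ne T x p w τ) {σ : ℝ} (hσ : σ ≤ T) :
    cross (x σ) (p σ) = cross (x T) (p T) := by
  refine eq_of_deriv_eq_zero (f := fun σ => cross (x σ) (p σ)) hσ le_rfl fun s hs => ?_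
  refine (hasDerivWithinAt_cross (h.deriv_x s hs) (h.deriv_p s hs)).congr_deriv ?_
  rw [cross_smul_left, cross_smul_right, cross_self_eq_zero, cross_self_eq_zero, smul_zero,
    smul_zero, add_zero]

/-- The conserved angular momentum is orthogonal to p(σ) for all σ, hence to its limit. -/
theorem inner_angular_direction (h : IsRay S μ Ne T x p w τ) :
    inner ℝ (cross (x T) (p T)) Ne = (0 : ℝ) := by
  have h1 : Tendsto (fun σ => (inner ℝ (cross (x T) (p T)) (p σ) : ℝ)) atBot
      (𝓝 (inner ℝ (cross (x T) (p T)) Ne)) := tendsto_const_nhds.inner h.tendsto_p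
  refine tendsto_nhds_unique h1 (tendsto_const_nhds.congr' ?_)
  filter_upwards [eventually_le_atBot T] with σ hσ
  rw [← h.cross_eq hσ, inner_cross_self_right]

/-- A ray of large angular momentum coming from infinity stays far from the centre. -/
theorem far_of_angular (h : IsRay S μ Ne T x p w τ) (hμ : 0 < μ) {b u₀ : ℝ} (hu₀ : 0 < u₀)
    (hindex : ∀ u, 0 ≤ u → u ≤ u₀ → S.index u ≤ 4) (hL : ‖cross (x T) (p T)‖ = b)
    (hsmall : 2 * μ < u₀ * b) {σ : ℝ} (hσ : σ ≤ T) : μ / ‖x σ‖ ≤ u₀ ∧ b ≤ 2 * ‖x σ‖ := by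
  have hle : ∀ σ ≤ T, μ / ‖x σ‖ ≤ u₀ → b ≤ 2 * ‖x σ‖ := by
    intro σ hσ hu
    have hp : ‖p σ‖ ≤ 2 := by
      apply le_of_sq_le_sq _ two_pos.le
      rw [h.norm_sq_p σ hσ]
      exact (hindex _ (by positivity) hu).trans (by norm_num)
    rw [← hL, ← h.cross_eq hσ]
    refine (norm_cross_le _ _).trans ?_
    rw [mul_comm]
    exact mul_le_mul_of_nonneg_right hp (norm_nonneg _)
  have hfar : ∀ σ ≤ T, -‖x σ‖ < -(μ / u₀) := by
    refine lt_of_continuation ?_ ?_ ?_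
    · exact fun σ hσ => (h.deriv_x σ hσ).continuousWithinAt.norm.neg
    · filter_upwards [h.tendsto_x.eventually_gt_atTop (μ / u₀)] with σ hσ
      exact neg_lt_neg hσ
    · intro t ht hlt
      -- The weak inequality passes to the left limit; then b ≤ 2r and 2μ < u₀ b make it strict
      -- again.
      have hge : μ / u₀ ≤ ‖x t‖ := by
        have hc : Tendsto (fun σ => ‖x σ‖) (𝓝[<] t) (𝓝 ‖x t‖) :=
          ((h.deriv_x t ht).continuousWithinAt.norm).mono fun s hs => (le_of_lt hs).trans ht
        refine ge_of_tendsto hc ?_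
        filter_upwards [self_mem_nhdsWithin] with s hs
        exact (neg_lt_neg_iff.1 (hlt s hs)).le
      have hb := hle t ht ((div_le_comm₀ (h.norm_pos hμ.le ht) hu₀).2 hge)
      rw [neg_lt_neg_iff, div_lt_iff₀ hu₀]
      nlinarith
  have hu := (div_le_comm₀ (h.norm_pos hμ.le hσ) hu₀).2 (neg_lt_neg_iff.1 (hfar σ hσ)).le
  exact ⟨hu, hle σ hσ hu⟩

/-- A ray that stays far from the centre is hardly deflected. -/
theorem norm_sub_direction_le (h : IsRay S μ Ne T x p w τ) (hμ : 0 < μ) {b H : ℝ} (hb : 0 < b)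
    (hNe : ‖Ne‖ = 1) (hbr : ∀ σ ≤ T, b ≤ 2 * ‖x σ‖)
    (hH : ∀ σ ≤ T, |deriv S.index (μ / ‖x σ‖)| ≤ H)
    (hsmall : 4 * Real.pi * H * (μ / b) < 1 / 2) :
    ∀ σ ≤ T, ‖p σ - Ne‖ ≤ 4 * Real.pi * H * (μ / b) := by
  have hstep : ∀ t ≤ T, (∀ σ < t, ‖p σ - Ne‖ < 1 / 2) →
      ‖p t - Ne‖ ≤ 4 * Real.pi * H * (μ / b) := by
    intro t ht hlt
    have hH0 : 0 ≤ H := (abs_nonneg _).trans (hH t ht)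
    have hz : ∀ σ ≤ T, HasDerivWithinAt (fun s => 2 / b * (inner ℝ Ne (x s) : ℝ))
        (2 / b * (w σ * inner ℝ Ne (p σ))) (Set.Iic T) σ := by
      intro σ hσ
      refine (((hasDerivWithinAt_const σ (Set.Iic T) Ne).inner ℝ
        (h.deriv_x σ hσ)).const_mul (2 / b)).congr_deriv ?_
      rw [inner_zero_left, add_zero, real_inner_smul_right]
    -- While |p - N_e| < 1/2 one has z' ≥ w/2. With r ≥ b/2 and r ≥ |z| this bounds |p'|, which is
    -- at most of order w/r², by the derivative of a multiple of arctan(2z/b), of total variation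
    -- below π.
    have hg : ∀ σ ≤ T, HasDerivWithinAt
        (fun s => 4 * H * (μ / b) * Real.arctan (2 / b * (inner ℝ Ne (x s) : ℝ)))
        (4 * H * (μ / b) * (1 / (1 + (2 / b * (inner ℝ Ne (x σ) : ℝ)) ^ 2) *
          (2 / b * (w σ * inner ℝ Ne (p σ))))) (Set.Iic T) σ := fun σ hσ =>
      ((hz σ hσ).arctan).const_mul _
    have hbound : ∀ σ < t, ‖(-(w σ * μ / (2 * ‖x σ‖ ^ 3) * deriv S.index (μ / ‖x σ‖))) • x σ‖ ≤
        4 * H * (μ / b) * (1 / (1 + (2 / b * (inner ℝ Ne (x σ) : ℝ)) ^ 2) *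
          (2 / b * (w σ * inner ℝ Ne (p σ)))) := by
      intro σ hσ
      have hσT := hσ.le.trans ht
      have hr := h.norm_pos hμ.le hσT
      have hw := h.w_pos σ hσT
      have hpz : 1 / 2 ≤ (inner ℝ Ne (p σ) : ℝ) := by
        have e1 : (inner ℝ Ne (p σ) : ℝ) = 1 + inner ℝ Ne (p σ - Ne) := by
          rw [inner_sub_right, real_inner_self_eq_norm_sq, hNe]; ring
        have e2 := abs_real_inner_le_norm Ne (p σ - Ne)
        rw [hNe, one_mul] at e2
        have := (abs_le.1 (e2.trans (hlt σ hσ).le)).1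
        linarith
      have hz2 : (inner ℝ Ne (x σ) : ℝ) ^ 2 ≤ ‖x σ‖ ^ 2 := by
        have := abs_real_inner_le_norm Ne (x σ)
        rw [hNe, one_mul] at this
        exact sq_le_sq' (abs_le.1 this).1 (abs_le.1 this).2
      have hb2 := hbr σ hσT
      rw [norm_smul, norm_neg, Real.norm_eq_abs, abs_mul,
        abs_of_pos (by positivity : 0 < w σ * μ / (2 * ‖x σ‖ ^ 3))]
      have hden : 1 + (2 / b * (inner ℝ Ne (x σ) : ℝ)) ^ 2 ≤ 8 * ‖x σ‖ ^ 2 / b ^ 2 := by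
        rw [le_div_iff₀ (by positivity)]
        have : (1 + (2 / b * (inner ℝ Ne (x σ) : ℝ)) ^ 2) * b ^ 2 =
            b ^ 2 + 4 * (inner ℝ Ne (x σ) : ℝ) ^ 2 := by field_simp; ring
        rw [this]
        nlinarith
      have hden' : 1 / (8 * ‖x σ‖ ^ 2 / b ^ 2) ≤
          1 / (1 + (2 / b * (inner ℝ Ne (x σ) : ℝ)) ^ 2) :=
        one_div_le_one_div_of_le (by positivity) hden
      calc w σ * μ / (2 * ‖x σ‖ ^ 3) * |deriv S.index (μ / ‖x σ‖)| * ‖x σ‖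
          ≤ w σ * μ / (2 * ‖x σ‖ ^ 3) * H * ‖x σ‖ := by gcongr; exact hH σ hσT
        _ = 4 * H * (μ / b) * (1 / (8 * ‖x σ‖ ^ 2 / b ^ 2) * (2 / b * (w σ * (1 / 2)))) := by
          field_simp; ring
        _ ≤ _ := by gcongr
    have hlim := (h.tendsto_p.const_sub (p t)).norm
    refine le_of_tendsto hlim ?_
    filter_upwards [eventually_le_atBot t] with a ha
    have hmv := norm_sub_le_sub_of_norm_deriv_le ha ht (fun σ _ h2 => h.deriv_p σ (h2.trans ht))
      (fun σ _ h2 => hg σ (h2.trans ht)) (fun σ _ h2 => hbound σ h2)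
    have h1 := Real.arctan_lt_pi_div_two (2 / b * (inner ℝ Ne (x t) : ℝ))
    have h2 := Real.neg_pi_div_two_lt_arctan (2 / b * (inner ℝ Ne (x a) : ℝ))
    have h3 : 0 ≤ 4 * H * (μ / b) := by positivity
    refine hmv.trans ?_
    rw [← mul_sub]
    calc _ ≤ 4 * H * (μ / b) * Real.pi := mul_le_mul_of_nonneg_left (by linarith) h3
      _ = _ := by ring
  -- Bootstrap: the bound 1/2 before t implies a strictly better bound at t.
  have hall : ∀ σ ≤ T, ‖p σ - Ne‖ < 1 / 2 := by
    refine lt_of_continuation ?_ ?_ fun t ht hlt => (hstep t ht hlt).trans_lt hsmall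
    · exact fun σ hσ => ((h.deriv_p σ hσ).continuousWithinAt.sub continuousWithinAt_const).norm
    · have : Tendsto (fun σ => ‖p σ - Ne‖) atBot (𝓝 0) := by
        simpa using (h.tendsto_p.sub_const Ne).norm
      exact this.eventually (gt_mem_nhds (by norm_num))
  exact fun t ht => hstep t ht fun σ hσ => hall σ (hσ.le.trans ht)

/-- Reduction to the plane of the motion. -/
theorem isPlaneRay (h : IsRay S μ Ne T x p w τ) (hμ : 0 ≤ μ) (hNe : ‖Ne‖ = 1) {b : ℝ}
    (hb : 0 < b) {M : Triple} (hM : ‖M‖ = 1) (hL : cross (x T) (p T) = b • M) :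
    (∀ σ ≤ T, inner ℝ (x σ) M = (0 : ℝ)) ∧ (∀ σ ≤ T, inner ℝ (p σ) M = (0 : ℝ)) ∧
    inner ℝ Ne M = (0 : ℝ) ∧
    IsPlaneRay S μ b T (fun σ => inner ℝ (x σ) Ne) (fun σ => inner ℝ (x σ) (cross Ne M))
      (fun σ => inner ℝ (p σ) Ne) (fun σ => inner ℝ (p σ) (cross Ne M)) w (fun σ => ‖x σ‖) := by
  have hxM : ∀ σ ≤ T, inner ℝ (x σ) M = (0 : ℝ) := by
    intro σ hσ
    have := inner_cross_self_left (x σ) (p σ)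
    rw [h.cross_eq hσ, hL, real_inner_smul_left, real_inner_comm] at this
    exact (mul_eq_zero.1 this).resolve_left hb.ne'
  have hpM : ∀ σ ≤ T, inner ℝ (p σ) M = (0 : ℝ) := by
    intro σ hσ
    have := inner_cross_self_right (x σ) (p σ)
    rw [h.cross_eq hσ, hL, real_inner_smul_left, real_inner_comm] at this
    exact (mul_eq_zero.1 this).resolve_left hb.ne'
  have hNM : inner ℝ Ne M = (0 : ℝ) := by
    have := h.inner_angular_direction
    rw [hL, real_inner_smul_left, real_inner_comm] at this
    exact (mul_eq_zero.1 this).resolve_left hb.ne'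
  have hMN : inner ℝ M Ne = (0 : ℝ) := by rw [real_inner_comm]; exact hNM
  have hdx : ∀ v : Triple, ∀ σ ≤ T, HasDerivWithinAt (fun s => (inner ℝ (x s) v : ℝ))
      (w σ * inner ℝ (p σ) v) (Set.Iic T) σ := fun v σ hσ => by
    refine ((h.deriv_x σ hσ).inner ℝ (hasDerivWithinAt_const σ (Set.Iic T) v)).congr_deriv ?_
    rw [inner_zero_right, zero_add, real_inner_smul_left]
  have hdp : ∀ v : Triple, ∀ σ ≤ T, HasDerivWithinAt (fun s => (inner ℝ (p s) v : ℝ))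
      (-(w σ * μ / (2 * ‖x σ‖ ^ 3) * deriv S.index (μ / ‖x σ‖)) * inner ℝ (x σ) v)
      (Set.Iic T) σ := fun v σ hσ => by
    refine ((h.deriv_p σ hσ).inner ℝ (hasDerivWithinAt_const σ (Set.Iic T) v)).congr_deriv ?_
    rw [inner_zero_right, zero_add, real_inner_smul_left]
  refine ⟨hxM, hpM, hNM, h.w_pos, fun σ hσ => h.norm_pos hμ hσ, fun σ hσ => ?_, hdx Ne, hdx _,
    hdp Ne, hdp _, fun σ hσ => ?_, h.tendsto_x, ?_, ?_⟩
  · have e := eq_smul_add_smul_of_orthonormal hNe hM hNM (hxM σ hσ)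
    have e2 := congrArg (fun v => (inner ℝ (x σ) v : ℝ)) e
    simp only [inner_add_right, real_inner_smul_right, real_inner_self_eq_norm_sq] at e2
    rw [e2]
    ring
  · have e := inner_cross_cross (x σ) (p σ) (cross Ne M) Ne
    rw [cross_cross_left, hMN, zero_smul, sub_zero, real_inner_self_eq_norm_sq, hNe, one_pow,
      one_smul, h.cross_eq hσ, hL, real_inner_smul_left, real_inner_self_eq_norm_sq, hM] at e
    linarith
  · have := h.tendsto_p.inner (𝕜 := ℝ) (tendsto_const_nhds (x := Ne))
    rwa [real_inner_self_eq_norm_sq, hNe, one_pow] at this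
  · have := h.tendsto_p.inner (𝕜 := ℝ) (tendsto_const_nhds (x := cross Ne M))
    rwa [real_inner_comm, inner_cross_self_left] at this

theorem deriv_norm (h : IsRay S μ Ne T x p w τ) (hμ : 0 ≤ μ) {σ : ℝ} (hσ : σ ≤ T) :
    HasDerivWithinAt (fun s => ‖x s‖) (w σ * inner ℝ (x σ) (p σ) / ‖x σ‖) (Set.Iic T) σ := by
  have hr := h.norm_pos hμ hσ
  have h1 := (h.deriv_x σ hσ).norm_sq.sqrt (pow_pos hr 2).ne'
  simp only [Real.sqrt_sq (norm_nonneg _)] at h1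
  refine h1.congr_deriv ?_
  rw [real_inner_smul_right]
  exact mul_div_mul_left _ _ two_ne_zero

/-- The radial part of the velocity cancels, so p enters only through x × p: without angular
momentum the direction of x is constant. -/
theorem deriv_unit (h : IsRay S μ Ne T x p w τ) (hμ : 0 ≤ μ) {σ : ℝ} (hσ : σ ≤ T) :
    HasDerivWithinAt (fun s => ‖x s‖⁻¹ • x s)
      ((w σ / ‖x σ‖ ^ 3) • cross (cross (x σ) (p σ)) (x σ)) (Set.Iic T) σ := by
  have hr := h.norm_pos hμ hσ
  refine (((h.deriv_norm hμ hσ).fun_inv hr.ne').fun_smul (h.deriv_x σ hσ)).congr_deriv ?_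
  rw [cross_cross_left, real_inner_self_eq_norm_sq, real_inner_comm (x σ) (p σ)]
  match_scalars <;> field_simp

/-- A ray without angular momentum moves on the axis through the centre. -/
theorem cross_direction_eq_zero_of_radial (h : IsRay S μ Ne T x p w τ) (hμ : 0 ≤ μ)
    (hL : cross (x T) (p T) = 0) : cross (x T) Ne = 0 := by
  have hinv : ∀ σ ≤ T, HasDerivWithinAt (fun s => ‖x s‖⁻¹ • x s) 0 (Set.Iic T) σ := by
    intro σ hσ
    refine (h.deriv_unit hμ hσ).congr_deriv ?_
    rw [h.cross_eq hσ, hL, cross_zero_left, smul_zero]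
  have hcross : ∀ σ ≤ T, cross (x T) (p σ) = 0 := by
    intro σ hσ
    have e := eq_of_deriv_eq_zero hσ le_rfl hinv
    have hr := (h.norm_pos hμ hσ).ne'
    have hrT := (h.norm_pos hμ le_rfl).ne'
    have e2 : x T = (‖x T‖ * ‖x σ‖⁻¹) • x σ := by
      rw [mul_smul, e, smul_smul, mul_inv_cancel₀ hrT, one_smul]
    rw [e2, cross_smul_left, h.cross_eq hσ, hL, smul_zero]
  have h1 : Tendsto (fun σ => cross (x T) (p σ)) atBot (𝓝 (cross (x T) Ne)) :=
    tendsto_cross tendsto_const_nhds h.tendsto_p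
  refine tendsto_nhds_unique h1 (tendsto_const_nhds.congr' ?_)
  filter_upwards [eventually_le_atBot T] with σ hσ
  exact (hcross σ hσ).symm

/-! ### The final arc of a ray and its sense of rotation -/

/-- A ray whose speed near its end is at most `V` cannot leave a ball around its end in a short
time. -/
theorem norm_sub_end_lt (h : IsRay S μ Ne T x p w τ) (hμ : 0 ≤ μ) {ρ V σ₁ : ℝ}
    (hV0 : 0 ≤ V) (hρ : 0 < ρ)
    (hV : ∀ σ ≤ T, ‖x σ - x T‖ ≤ ρ → 1 ≤ V ^ 2 * S.index (μ / ‖x σ‖))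
    (htime : V * (τ T - τ σ₁) < ρ) : ∀ σ, σ₁ ≤ σ → σ ≤ T → ‖x σ - x T‖ < ρ := by
  -- The coordinate speed is |p|/N = N^(-1/2), so 1 ≤ V² N says precisely that V bounds it.
  have hspeed : ∀ σ ≤ T, ‖x σ - x T‖ ≤ ρ →
      ‖w σ • p σ‖ ≤ V * (w σ * S.index (μ / ‖x σ‖)) := by
    intro σ hσ hin
    have hw := h.w_pos σ hσ
    have hi := h.index_pos hμ hσ
    have hp : ‖p σ‖ ≤ V * S.index (μ / ‖x σ‖) := by
      apply le_of_sq_le_sq _ (by positivity)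
      rw [h.norm_sq_p σ hσ]
      nlinarith [hV σ hσ hin]
    rw [norm_smul, Real.norm_eq_abs, abs_of_pos hw]
    have := mul_le_mul_of_nonneg_left hp hw.le
    linarith
  have hcont : ContinuousOn (fun σ => ‖x σ - x T‖) (Set.Iic T) := fun σ hσ =>
    ((h.deriv_x σ hσ).continuousWithinAt.sub continuousWithinAt_const).norm
  by_contra hcon
  push Not at hcon
  obtain ⟨σ₂, h12, h2T, h2⟩ := hcon
  let s : Set ℝ := {σ | σ ∈ Set.Icc σ₁ T ∧ ρ ≤ ‖x σ - x T‖}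
  have hs : IsCompact s := isCompact_Icc.of_isClosed_subset
    ((hcont.mono fun σ (hσ : σ ∈ Set.Icc σ₁ T) => hσ.2).preimage_isClosed_of_isClosed
      isClosed_Icc isClosed_Ici) fun σ hσ => hσ.1
  -- After the last time c outside the open ball the speed bound holds, so a distance ρ would have
  -- to be covered in too short a time.
  obtain ⟨c, hc⟩ := hs.exists_isGreatest ⟨σ₂, ⟨h12, h2T⟩, h2⟩
  have hcT : c < T := by
    refine lt_of_le_of_ne hc.1.1.2 fun e => ?_
    have := hc.1.2
    rw [e, sub_self, norm_zero] at this
    linarith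
  have hin : ∀ σ, c < σ → σ ≤ T → ‖x σ - x T‖ < ρ := by
    intro σ hcσ hσ
    by_contra hge
    exact absurd (hc.2 ⟨⟨hc.1.1.1.trans hcσ.le, hσ⟩, not_lt.1 hge⟩) (not_le.2 hcσ)
  have hcle : ‖x c - x T‖ ≤ ρ := by
    have hca : ContinuousAt (fun σ => ‖x σ - x T‖) c :=
      (hcont c hcT.le).continuousAt (Iic_mem_nhds hcT)
    refine le_of_tendsto (hca.tendsto.mono_left (nhdsWithin_le_nhds (s := Set.Ioi c))) ?_
    filter_upwards [Ioc_mem_nhdsGT hcT] with σ hσ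
    exact (hin σ hσ.1 hσ.2).le
  have hmv := norm_sub_le_sub_of_norm_deriv_le hcT.le le_rfl
    (fun σ _ h2 => h.deriv_x σ h2) (fun σ _ h2 => (h.deriv_time σ h2).const_mul V)
    (fun σ h1 h2 => hspeed σ h2.le (by
      rcases h1.eq_or_lt with rfl | h1
      · exact hcle
      · exact (hin σ h1 h2.le).le))
  have hτ : τ σ₁ ≤ τ c := by
    rcases hc.1.1.1.eq_or_lt with e | hlt
    · rw [e]
    · exact (lt_of_deriv_pos hlt hcT.le (fun σ _ h2 => h.deriv_time σ (h2.trans hcT.le))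
        fun σ _ h2 => mul_pos (h.w_pos σ (h2.le.trans hcT.le))
          (h.index_pos hμ (h2.le.trans hcT.le))).le
  have h3 := hc.1.2
  rw [norm_sub_rev] at hmv
  have := mul_le_mul_of_nonneg_left hτ hV0
  linarith

/-- The sense of rotation can be read off from two nearby points of the ray. -/
theorem inner_cross_end_pos (h : IsRay S μ Ne T x p w τ) {σ₁ : ℝ} (h1 : σ₁ < T)
    (hnear : ∀ σ, σ₁ ≤ σ → σ ≤ T → ‖x σ - x T‖ < ‖x T‖) {W : Triple}
    (hW : 0 < (inner ℝ (cross (x T) (p T)) W : ℝ)) :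
    0 < (inner ℝ (cross (x σ₁) (x T)) W : ℝ) := by
  have hpos : ∀ σ, σ₁ ≤ σ → σ ≤ T → 0 < (inner ℝ (x σ) (x T) : ℝ) := by
    intro σ hσ1 hσ
    have e : (inner ℝ (x σ) (x T) : ℝ) = ‖x T‖ ^ 2 + inner ℝ (x σ - x T) (x T) := by
      rw [inner_sub_left, real_inner_self_eq_norm_sq]; ring
    have e2 := (abs_le.1 (abs_real_inner_le_norm (x σ - x T) (x T))).1
    have e3 := hnear σ hσ1 hσ
    have e4 : 0 < ‖x T‖ := (norm_nonneg _).trans_lt e3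
    nlinarith
  have hXL : inner ℝ (x T) (cross (x T) (p T)) = (0 : ℝ) := by
    rw [real_inner_comm, inner_cross_self_left]
  have hXX : 0 < (inner ℝ (x T) (x T) : ℝ) := hpos T h1.le le_rfl
  -- A tangent-like function of the angle between x(σ) and x(T), which vanishes at T; conservation
  -- of angular momentum fixes the sign of its derivative.
  have hlt : -((inner ℝ (cross (x σ₁) (x T)) W : ℝ) / inner ℝ (x σ₁) (x T)) <
      -((inner ℝ (cross (x T) (x T)) W : ℝ) / inner ℝ (x T) (x T)) := by
    refine lt_of_deriv_pos
      (f := fun σ => -((inner ℝ (cross (x σ) (x T)) W : ℝ) / inner ℝ (x σ) (x T)))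
      (f' := fun σ => w σ * (inner ℝ (x T) (x T) * inner ℝ (cross (x T) (p T)) W) /
        (inner ℝ (x σ) (x T)) ^ 2) h1 le_rfl (fun σ hσ1 hσ => ?_) (fun σ hσ1 hσ => ?_)
    · have hd1 := (hasDerivWithinAt_cross (h.deriv_x σ hσ)
        (hasDerivWithinAt_const σ (Set.Iic T) (x T))).inner ℝ
        (hasDerivWithinAt_const σ (Set.Iic T) W)
      have hd2 := (h.deriv_x σ hσ).inner ℝ (hasDerivWithinAt_const σ (Set.Iic T) (x T))
      refine ((hd1.div hd2 (hpos σ hσ1 hσ).ne').neg).congr_deriv ?_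
      have key := inner_cross_mul_sub (x σ) (p σ) (x T) W
      rw [h.cross_eq hσ, hXL, zero_mul, zero_sub] at key
      rw [cross_zero_right, add_zero, inner_zero_right, zero_add, inner_zero_right, zero_add,
        cross_smul_left, real_inner_smul_left, real_inner_smul_left, ← neg_div]
      congr 1
      linear_combination (-w σ) * key
    · have := h.w_pos σ hσ.le
      have := hpos σ hσ1.le hσ.le
      positivity
  rw [cross_self_eq_zero, inner_zero_left, zero_div, neg_zero, neg_lt_zero] at hlt
  exact (div_pos_iff_of_pos_right (hpos σ₁ le_rfl h1.le)).1 hlt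

end IsRay
-- Dependence on the mass parameter
-- Convergence at μ = m is absolute in finite dimension and dominates the series for all smaller μ.
theorem continuousOn_of_hasSum_pow_smul {m : ℝ} (hm : 0 ≤ m) {X : ℕ → Event} {G : ℝ → Event}
    {e : Event} (h : ∀ μ ∈ Set.Icc 0 m,
      HasSum (fun n : ℕ => μ ^ (n + 1) • X (n + 1)) (G μ - e)) :
    ContinuousOn G (Set.Icc 0 m) := by
  have hsum := (h m ⟨hm, le_rfl⟩).summable.norm
  have hc : ContinuousOn (fun μ : ℝ => ∑' n : ℕ, μ ^ (n + 1) • X (n + 1)) (Set.Icc 0 m) := by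
    refine continuousOn_tsum (fun n => by fun_prop) hsum fun n μ hμ => ?_
    rw [norm_smul, norm_smul, norm_pow, norm_pow, Real.norm_eq_abs, Real.norm_eq_abs,
      abs_of_nonneg hμ.1, abs_of_nonneg hm]
    have := pow_le_pow_left₀ hμ.1 hμ.2 (n + 1)
    gcongr
  refine (hc.add (continuousOn_const (c := e))).congr fun μ hμ => ?_
  rw [Pi.add_apply, (h μ hμ).tsum_eq, sub_add_cancel]

theorem IsRay.direction_of_massless {S : Potentials} {T : ℝ} {Ne : Triple} {x p : ℝ → Triple}
    {w τ : ℝ → ℝ} (h : IsRay S 0 Ne T x p w τ) : p T = Ne := by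
  have hd : ∀ σ ≤ T, HasDerivWithinAt p 0 (Set.Iic T) σ := fun σ hσ => by
    simpa using h.deriv_p σ hσ
  refine tendsto_nhds_unique (tendsto_const_nhds.congr' ?_) h.tendsto_p
  filter_upwards [eventually_le_atBot T] with σ hσ
  exact eq_of_deriv_eq_zero le_rfl hσ hd

/-- In a continuous family of rays with the same end and the same incoming direction, starting
from a straight line, all rays pass the centre on the same side. -/
theorem inner_angular_pos_of_family {S : Potentials} {m T : ℝ} {Ne X : Triple} (hm : 0 ≤ m)
    {x p : ℝ → ℝ → Triple} {w τ : ℝ → ℝ → ℝ}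
    (h : ∀ μ ∈ Set.Icc 0 m, IsRay S μ Ne T (x μ) (p μ) (w μ) (τ μ))
    (hX : ∀ μ ∈ Set.Icc 0 m, x μ T = X)
    (hx : ∀ σ ≤ T, ContinuousOn (fun μ => x μ σ) (Set.Icc 0 m))
    (hτ : ∀ σ ≤ T, ContinuousOn (fun μ => τ μ σ) (Set.Icc 0 m))
    (hne : cross X Ne ≠ 0) : 0 < (inner ℝ (cross X (p m T)) (cross X Ne) : ℝ) := by
  set W := cross X Ne with hW
  set Q : ℝ → ℝ := fun μ => inner ℝ (cross X (p μ T)) W with hQ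
  have h0mem : (0 : ℝ) ∈ Set.Icc 0 m := ⟨le_rfl, hm⟩
  -- The angular momentum and W are both orthogonal to X and N_e, so their cross product vanishes.
  -- If Q vanished too, the angular momentum would be 0, the ray radial and W = 0.
  have hQne : ∀ μ ∈ Set.Icc 0 m, Q μ ≠ 0 := by
    intro μ hμ hzero
    have hL : cross X (p μ T) = 0 := by
      have hLN : inner ℝ (cross X (p μ T)) Ne = (0 : ℝ) := by
        have := (h μ hμ).inner_angular_direction
        rwa [hX μ hμ] at this
      have hLX : inner ℝ (cross X (p μ T)) X = (0 : ℝ) := inner_cross_self_left _ _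
      have hcr : cross W (cross X (p μ T)) = 0 := by
        rw [hW, cross_cross_left, real_inner_comm, hLX, real_inner_comm, hLN]; simp
      have hn := norm_cross_sq W (cross X (p μ T))
      rw [hcr, real_inner_comm, show (inner ℝ (cross X (p μ T)) W : ℝ) = 0 from hzero] at hn
      simp only [norm_zero, ne_eq, OfNat.ofNat_ne_zero, not_false_eq_true, zero_pow,
        sub_zero] at hn
      rcases mul_eq_zero.1 hn.symm with e | e
      · exact absurd (norm_eq_zero.1 (pow_eq_zero_iff two_ne_zero |>.1 e)) hne
      · exact norm_eq_zero.1 (pow_eq_zero_iff two_ne_zero |>.1 e)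
    refine hne ?_
    have := (h μ hμ).cross_direction_eq_zero_of_radial hμ.1 (by rw [hX μ hμ]; exact hL)
    rwa [hX μ hμ] at this
  have hQ0 : 0 < Q 0 := by
    have e : p 0 T = Ne := (h 0 h0mem).direction_of_massless
    simp only [hQ, e]
    rw [← hW, real_inner_self_eq_norm_sq]
    exact pow_pos (norm_pos_iff.2 hne) 2
  -- Continuity in μ is given for positions and times, not for p at the end. So the sign of Q is
  -- read off from `Q₁`, built from the positions at σ₁ and T, with one σ₁ serving all μ near μ₀.
  have hlocal : ∀ μ₀ ∈ Set.Icc 0 m, ∀ᶠ μ in 𝓝[Set.Icc 0 m] μ₀, (0 < Q μ ↔ 0 < Q μ₀) := by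
    intro μ₀ hμ₀
    have hk := S.k_pos
    have hout : S.k * μ₀ < ‖X‖ := by
      have := (h μ₀ hμ₀).outside T le_rfl
      rwa [hX μ₀ hμ₀] at this
    have hkμ : 0 ≤ S.k * μ₀ := mul_nonneg hk.le hμ₀.1
    -- R lies strictly between the horizon and the end, so the ball of radius ‖X‖ - R about X stays
    -- in a region where the index is bounded below.
    set R := (S.k * μ₀ + ‖X‖) / 2 with hR
    have hR1 : S.k * μ₀ < R := by rw [hR]; linarith
    have hR2 : R < ‖X‖ := by rw [hR]; linarith
    have hR0 : 0 < R := hkμ.trans_lt hR1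
    obtain ⟨-, hu0, hu1⟩ := div_lt_inv_of_outside hk hμ₀.1 hR1
    set u₁ := (μ₀ / R + 1 / S.k) / 2 with hu₁
    have hu₁1 : μ₀ / R < u₁ := by rw [hu₁]; linarith
    have hu₁k : u₁ < 1 / S.k := by rw [hu₁]; linarith
    have hcinv : ContinuousOn (fun u => (S.index u)⁻¹) (Set.Icc 0 u₁) := by
      refine ContinuousOn.inv₀ (fun u hu => ?_) fun u hu => ?_
      · exact (S.analyticAt_index hu.1 (hu.2.trans_lt hu₁k)).continuousAt.continuousWithinAt
      · exact (S.index_pos hu.1 (hu.2.trans_lt hu₁k)).ne'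
    obtain ⟨V₀, hV₀⟩ := isCompact_Icc.exists_bound_of_continuousOn hcinv
    have hV₀0 : 0 ≤ V₀ := (norm_nonneg _).trans (hV₀ 0 ⟨le_rfl, by linarith⟩)
    -- The shift by 1 gives V₀ ≤ V² without a square root.
    set V := V₀ + 1 with hV
    have hV0 : 0 ≤ V := by linarith
    have hVu : ∀ u ∈ Set.Icc 0 u₁, 1 ≤ V ^ 2 * S.index u := by
      intro u hu
      have hi := S.index_pos hu.1 (hu.2.trans_lt hu₁k)
      have h1 := hV₀ u hu
      rw [Real.norm_eq_abs, abs_of_pos (inv_pos.2 hi)] at h1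
      have h2 : (S.index u)⁻¹ ≤ V ^ 2 := h1.trans (by rw [hV]; nlinarith)
      calc 1 = (S.index u)⁻¹ * S.index u := (inv_mul_cancel₀ hi.ne').symm
        _ ≤ _ := mul_le_mul_of_nonneg_right h2 hi.le
    have hρ : 0 < ‖X‖ - R := by linarith
    obtain ⟨σ₁, hσ₁T, hσ₁⟩ : ∃ σ₁ < T, V * (τ μ₀ T - τ μ₀ σ₁) < ‖X‖ - R := by
      have hc : Tendsto (τ μ₀) (𝓝[<] T) (𝓝 (τ μ₀ T)) :=
        ((h μ₀ hμ₀).deriv_time T le_rfl).continuousWithinAt.mono Set.Iio_subset_Iic_self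
      have hc2 := (hc.const_sub (τ μ₀ T)).const_mul V
      rw [sub_self, mul_zero] at hc2
      obtain ⟨s, hs1, hs2⟩ := ((hc2.eventually (gt_mem_nhds hρ)).and self_mem_nhdsWithin).exists
      exact ⟨s, hs2, hs1⟩
    set Q₁ : ℝ → ℝ := fun μ => inner ℝ (cross (x μ σ₁) X) W with hQ₁
    have hsign : ∀ μ ∈ Set.Icc 0 m, μ / R < u₁ → V * (τ μ T - τ μ σ₁) < ‖X‖ - R →
        (0 < Q μ → 0 < Q₁ μ) ∧ (Q μ < 0 → Q₁ μ < 0) := by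
      intro μ hμ hμR hτμ
      have hXμ := hX μ hμ
      have hspeed : ∀ σ ≤ T, ‖x μ σ - x μ T‖ ≤ ‖X‖ - R →
          1 ≤ V ^ 2 * S.index (μ / ‖x μ σ‖) := by
        intro σ _ hin
        rw [hXμ] at hin
        have hge : R ≤ ‖x μ σ‖ := by
          have := norm_sub_norm_le X (x μ σ)
          rw [norm_sub_rev] at this
          linarith
        refine hVu _ ⟨div_nonneg hμ.1 (norm_nonneg _), ?_⟩
        exact (div_le_div_of_nonneg_left hμ.1 hR0 hge).trans hμR.le
      have hnear := (h μ hμ).norm_sub_end_lt hμ.1 hV0 hρ hspeed hτμ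
      have hnear' : ∀ σ, σ₁ ≤ σ → σ ≤ T → ‖x μ σ - x μ T‖ < ‖x μ T‖ := fun σ h1 h2 => by
        have := hnear σ h1 h2
        rw [hXμ] at this ⊢
        linarith
      constructor
      · intro hpos
        have := (h μ hμ).inner_cross_end_pos hσ₁T hnear' (W := W) (by rw [hXμ]; exact hpos)
        rwa [hXμ] at this
      · intro hneg
        have := (h μ hμ).inner_cross_end_pos hσ₁T hnear' (W := -W) (by
          rw [hXμ, inner_neg_right]; exact neg_pos.2 hneg)
        rw [hXμ, inner_neg_right] at this
        exact neg_pos.1 this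
    have hQ₁c : ContinuousWithinAt Q₁ (Set.Icc 0 m) μ₀ :=
      (tendsto_cross (hx σ₁ hσ₁T.le μ₀ hμ₀) tendsto_const_nhds).inner tendsto_const_nhds
    have hev1 : ∀ᶠ μ in 𝓝[Set.Icc 0 m] μ₀, μ / R < u₁ :=
      ((continuous_id.div_const R).continuousWithinAt.tendsto).eventually (gt_mem_nhds hu₁1)
    have hev2 : ∀ᶠ μ in 𝓝[Set.Icc 0 m] μ₀, V * (τ μ T - τ μ σ₁) < ‖X‖ - R :=
      ((((hτ T le_rfl μ₀ hμ₀).sub (hτ σ₁ hσ₁T.le μ₀ hμ₀)).const_mul V).tendsto).eventually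
        (gt_mem_nhds hσ₁)
    have hs₀ := hsign μ₀ hμ₀ hu₁1 hσ₁
    rcases (hQne μ₀ hμ₀).lt_or_gt with hlt | hgt
    · filter_upwards [hev1, hev2, self_mem_nhdsWithin,
        hQ₁c.tendsto.eventually (gt_mem_nhds (hs₀.2 hlt))] with μ e1 e2 e3 e4
      have hs := hsign μ e3 e1 e2
      constructor
      · intro hpos
        exact absurd (hs.1 hpos) (not_lt.2 e4.le)
      · intro hpos
        exact absurd hpos (not_lt.2 hlt.le)
    · filter_upwards [hev1, hev2, self_mem_nhdsWithin,
        hQ₁c.tendsto.eventually (lt_mem_nhds (hs₀.1 hgt))] with μ e1 e2 e3 e4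
      have hs := hsign μ e3 e1 e2
      refine ⟨fun _ => hgt, fun _ => ?_⟩
      rcases (hQne μ e3).lt_or_gt with hl | hg
      · exact absurd (hs.2 hl) (not_lt.2 e4.le)
      · exact hg
  classical
  have hconst : decide (0 < Q m) = decide (0 < Q 0) := by
    refine (isPreconnected_Icc (a := (0 : ℝ)) (b := m)).constant (f := fun μ => decide (0 < Q μ))
      (fun μ₀ hμ₀ => ?_) ⟨hm, le_rfl⟩ h0mem
    refine (continuousWithinAt_const (b := decide (0 < Q μ₀))).congr_of_eventuallyEq ?_ rfl
    filter_upwards [hlocal μ₀ hμ₀] with μ hμ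
    exact decide_eq_decide.2 hμ
  exact (decide_eq_decide.1 hconst).2 hQ0

/-! ### Quasi-Minkowskian rays and the vectorial formula -/

theorem directionTriple_congr {g : Event → Matrix (Fin 4) (Fin 4) ℝ} {I : Set ℝ}
    {x y : ℝ → Event} (h : Set.EqOn x y I) {σ : ℝ} (hσ : σ ∈ I) :
    directionTriple g I x σ = directionTriple g I y σ := by
  simp only [directionTriple, covTangent, tangent, h hσ, derivWithin_congr h (h hσ)]

theorem spatial_event (t : ℝ) (v : Triple) : spatial (event t v) = v := by
  ext i
  simp [spatial, event]

theorem continuous_spatial : Continuous spatial :=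
  (PiLp.continuous_toLp 2 _).comp (continuous_pi fun i => continuous_apply i.succ)

/-- Polar description of a unit vector in the plane spanned by `N` and `N × M`. -/
theorem cross_unit_of_plane {N M v : Triple} {y : ℝ} (hN : ‖N‖ = 1) (hM : ‖M‖ = 1)
    (hNM : inner ℝ N M = (0 : ℝ)) (hv : inner ℝ v M = (0 : ℝ))
    (hvy : inner ℝ v (cross N M) = y) (hy : 0 < y) (hv0 : 0 < ‖v‖) :
    ‖cross N (unit v)‖ = y / ‖v‖ ∧ Pe N (unit v) = cross N M := by
  have hMN : inner ℝ M N = (0 : ℝ) := by rw [real_inner_comm]; exact hNM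
  have e := eq_smul_add_smul_of_orthonormal hN hM hNM hv
  have hc : cross N (cross N M) = -M := by
    rw [cross_swap, cross_cross_left, hMN, real_inner_self_eq_norm_sq, hN]; simp
  have hcv : cross N (unit v) = (y / ‖v‖) • -M := by
    have : cross N v = y • -M := by
      rw [e, cross_add_right, cross_smul_right, cross_smul_right, cross_self_eq_zero, smul_zero,
        zero_add, hc, hvy]
    rw [unit, cross_smul_right, this, smul_smul]
    congr 1
    ring
  have hpos : 0 < y / ‖v‖ := div_pos hy hv0
  have hn : ‖cross N (unit v)‖ = y / ‖v‖ := by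
    rw [hcv, norm_smul, norm_neg, hM, mul_one, Real.norm_eq_abs, abs_of_pos hpos]
  refine ⟨hn, ?_⟩
  rw [Pe, hn, hcv, smul_smul, inv_mul_cancel₀ hpos.ne', one_smul, cross_swap, cross_neg_right,
    neg_neg]

theorem IsRay.congr_x {S : Potentials} {μ T : ℝ} {Ne : Triple} {x x' p : ℝ → Triple}
    {w τ : ℝ → ℝ} (h : IsRay S μ Ne T x p w τ) (hx : ∀ σ ≤ T, x' σ = x σ) :
    IsRay S μ Ne T x' p w τ where
  outside σ hσ := by rw [hx σ hσ]; exact h.outside σ hσ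
  w_pos := h.w_pos
  deriv_x σ hσ := (h.deriv_x σ hσ).congr (fun s hs => hx s hs) (hx σ hσ)
  deriv_p σ hσ := by rw [hx σ hσ]; exact h.deriv_p σ hσ
  deriv_time σ hσ := by rw [hx σ hσ]; exact h.deriv_time σ hσ
  norm_sq_p σ hσ := by rw [hx σ hσ]; exact h.norm_sq_p σ hσ
  tendsto_x := h.tendsto_x.congr' (by
    filter_upwards [eventually_le_atBot T] with σ hσ
    rw [hx σ hσ])
  tendsto_p := h.tendsto_p

/-- A quasi-Minkowskian light ray passes the centre on the side of its end. -/
theorem IsQuasiMinkowskian.exists_isRay {S : Potentials} {m T : ℝ} {Ne : Triple} {x : ℝ → Event}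
    (hqm : IsQuasiMinkowskian S m Ne T x) (hm : 0 < m) (hNe : ‖Ne‖ = 1) :
    ∃ (p : ℝ → Triple) (w τ : ℝ → ℝ), IsRay S m Ne T (fun s => spatial (x s)) p w τ ∧
      (∀ s ≤ T, directionTriple (S.metric m) (Set.Iic T) x s = -p s) ∧
      ((inner ℝ (spatial (x T)) Ne : ℝ) < 0 ∨
        0 < (inner ℝ (cross (spatial (x T)) (p T)) (cross (spatial (x T)) Ne) : ℝ)) := by
  obtain ⟨Γ, X, hΓx, hXT, hfam⟩ := hqm
  have hmm : m ∈ Set.Icc 0 m := ⟨hm.le, le_rfl⟩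
  have h0m : (0 : ℝ) ∈ Set.Icc 0 m := ⟨le_rfl, hm.le⟩
  have hEq : Set.EqOn x (Γ m) (Set.Iic T) := fun s hs => (hΓx s hs).symm
  have hrays : ∀ μ, ∃ w : ℝ → ℝ, μ ∈ Set.Icc 0 m → IsRay S μ Ne T (fun s => spatial (Γ μ s))
      (fun s => -directionTriple (S.metric μ) (Set.Iic T) (Γ μ) s) w (fun s => Γ μ s 0) := by
    intro μ
    by_cases hμ : μ ∈ Set.Icc 0 m
    · obtain ⟨-, hgeo, hout, hinf⟩ := hfam μ hμ.1 hμ.2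
      obtain ⟨w, hw⟩ := isRay_of_isNullGeodesicOn hμ.1 hgeo hout hinf
      exact ⟨w, fun _ => hw⟩
    -- Dummy value outside [0, m], so that `choose` gives a total family.
    · exact ⟨0, fun h => absurd h hμ⟩
  choose w hray using hrays
  have hΓc : ∀ s ≤ T, ContinuousOn (fun μ => Γ μ s) (Set.Icc 0 m) := fun s hs =>
    continuousOn_of_hasSum_pow_smul (X := fun n => X n s)
      (e := event (x T 0 + (s - T)) (spatial (x T) + (s - T) • Ne)) hm.le fun μ hμ =>
      (hfam μ hμ.1 hμ.2).1 s hs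
  have hend : ∀ μ ∈ Set.Icc 0 m, spatial (Γ μ T) = spatial (x T) := by
    intro μ hμ
    have h1 := (hfam μ hμ.1 hμ.2).1 T le_rfl
    have h2 : HasSum (fun n : ℕ => μ ^ (n + 1) • X (n + 1) T) 0 := by
      simp only [hXT _ (Nat.le_add_left 1 _), smul_zero]
      exact hasSum_zero
    rw [sub_eq_zero.1 (h1.unique h2), spatial_event]
    simp
  have hline : ∀ s ≤ T, spatial (Γ 0 s) = spatial (x T) + (s - T) • Ne := by
    intro s hs
    have h1 := (hfam 0 le_rfl hm.le).1 s hs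
    have h2 : HasSum (fun n : ℕ => (0 : ℝ) ^ (n + 1) • X (n + 1) s) 0 := by
      simp only [ne_eq, Nat.add_eq_zero_iff, one_ne_zero, and_false, not_false_eq_true, zero_pow,
        zero_smul]
      exact hasSum_zero
    rw [sub_eq_zero.1 (h1.unique h2), spatial_event]
  have hr := hray m hmm
  refine ⟨_, w m, fun s => Γ m s 0, hr.congr_x fun s hs => congrArg spatial (hEq hs), ?_, ?_⟩
  · intro s hs
    rw [neg_neg]
    exact directionTriple_congr hEq hs
  · by_cases hW : cross (spatial (x T)) Ne = 0
    · left
      by_contra hge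
      have e1 := cross_cross_left (spatial (x T)) Ne Ne
      rw [hW, cross_zero_left, real_inner_self_eq_norm_sq, hNe, one_pow, one_smul] at e1
      -- If the end lay on the axis with nonnegative component along N_e, the massless line would
      -- meet the centre at this parameter, though it stays in r > 0.
      have h1 := hline (T - inner ℝ (spatial (x T)) Ne) (by linarith)
      have h2 := (hfam 0 le_rfl hm.le).2.2.1 (T - inner ℝ (spatial (x T)) Ne) (by linarith)
      rw [h1, sub_sub_cancel_left, neg_smul, ← sub_eq_add_neg, ← neg_sub, ← e1, neg_zero,
        norm_zero, Potentials.rh, mul_zero] at h2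
      exact lt_irrefl _ h2
    · right
      exact inner_angular_pos_of_family hm.le (X := spatial (x T))
        (x := fun μ s => spatial (Γ μ s))
        (p := fun μ s => -directionTriple (S.metric μ) (Set.Iic T) (Γ μ) s) (w := w)
        (τ := fun μ s => Γ μ s 0) (fun μ hμ => hray μ hμ)
        hend (fun s hs => continuous_spatial.comp_continuousOn (hΓc s hs))
        (fun s hs => (continuous_apply 0).comp_continuousOn (hΓc s hs)) hW

/-- The direction of a ray with a large angular momentum `b` that passes the centre on the side of
its end. -/
theorem exists_direction_bound (S : Potentials) :
    ∃ δ₀ : ℝ, 0 < δ₀ ∧ ∃ C : ℝ,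
      ∀ (m b : ℝ) (Ne : Triple) (T : ℝ) (ξ p : ℝ → Triple) (w τ : ℝ → ℝ),
        0 < m → 0 < b → m / b ≤ δ₀ → ‖Ne‖ = 1 → IsRay S m Ne T ξ p w τ →
        ‖cross (ξ T) (p T)‖ = b →
        ((inner ℝ (ξ T) Ne : ℝ) < 0 ∨
          0 < (inner ℝ (cross (ξ T) (p T)) (cross (ξ T) Ne) : ℝ)) →
        ∀ σ ≤ T, ‖-p σ -
            (-Ne
              - (m * ‖cross Ne (unit (ξ σ))‖ / b *
                  (1 + S.γ + S.κ * m * ‖cross Ne (unit (ξ σ))‖ / b)) • Ne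
              + (m / b *
                  ((1 + S.γ) * (1 + inner ℝ Ne (unit (ξ σ))) +
                    S.κ * m / b *
                      (Real.pi - Real.arccos (inner ℝ Ne (unit (ξ σ))) +
                        ‖cross Ne (unit (ξ σ))‖ * inner ℝ Ne (unit (ξ σ))))) •
                Pe Ne (unit (ξ σ)))‖ ≤ C * (m / b) ^ 3 := by
  obtain ⟨u₀, K, hu₀, -, hK, hindex⟩ := S.exists_deriv_index_bound
  set H := 2 * |1 + S.γ| + 4 * |S.κ| * u₀ + K * u₀ ^ 2 with hH
  have hH0 : 0 ≤ H := by positivity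
  have hpi := Real.pi_pos
  -- The first entry gives 2m < u₀ b, the second a deflection below 1/2; the 4 keeps the denominator
  -- positive when H = 0. The factor 2 in the constant adds the errors along N_e and across it.
  refine ⟨min (u₀ / 4) (1 / (16 * Real.pi * H + 4)), by positivity,
    2 * ((2 * K + 4 * |S.κ| * (4 * Real.pi * H)) * Real.pi), ?_⟩
  intro m b Ne T ξ p w τ hm hb hδ hNe hr hLb hside₀ σ hσ
  have hδ1 : m / b ≤ u₀ / 4 := hδ.trans (min_le_left _ _)
  have hδ2 : m / b ≤ 1 / (16 * Real.pi * H + 4) := hδ.trans (min_le_right _ _)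
  have hδ0 : 0 < m / b := div_pos hm hb
  have hsmall : 4 * Real.pi * H * (m / b) < 1 / 2 := by
    rw [le_div_iff₀ (by positivity)] at hδ2
    nlinarith
  have hsmall' : 2 * m < u₀ * b := by
    rw [div_le_iff₀ hb] at hδ1
    nlinarith
  obtain ⟨M, hM⟩ : ∃ M : Triple, M = b⁻¹ • cross (ξ T) (p T) := ⟨_, rfl⟩
  have hL : cross (ξ T) (p T) = b • M := by
    rw [hM, smul_smul, mul_inv_cancel₀ hb.ne', one_smul]
  have hM1 : ‖M‖ = 1 := by
    rw [hM, norm_smul, hLb, norm_inv, Real.norm_eq_abs, abs_of_pos hb, inv_mul_cancel₀ hb.ne']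
  have hfar := fun s hs =>
    hr.far_of_angular (σ := s) hm hu₀ (fun u h0 h1 => (hindex u h0 h1).1) hLb hsmall' hs
  have hu : ∀ s ≤ T, 0 ≤ m / ‖ξ s‖ := fun s _ => div_nonneg hm.le (norm_nonneg _)
  have hHbd : ∀ s ≤ T, |deriv S.index (m / ‖ξ s‖)| ≤ H := by
    intro s hs
    have h1 := (hindex _ (hu s hs) (hfar s hs).1).2
    have h2 : |2 * (1 + S.γ) + 4 * S.κ * (m / ‖ξ s‖)| ≤ 2 * |1 + S.γ| + 4 * |S.κ| * u₀ := by
      refine (abs_add_le _ _).trans ?_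
      rw [abs_mul, abs_mul, abs_mul, abs_of_nonneg (hu s hs), abs_two,
        abs_of_pos (by norm_num : (0 : ℝ) < 4)]
      have := mul_le_mul_of_nonneg_left (hfar s hs).1 (by positivity : 0 ≤ 4 * |S.κ|)
      linarith
    have h3 : K * (m / ‖ξ s‖) ^ 2 ≤ K * u₀ ^ 2 :=
      mul_le_mul_of_nonneg_left (pow_le_pow_left₀ (hu s hs) (hfar s hs).1 2) hK
    have h4 := abs_add_le (deriv S.index (m / ‖ξ s‖) -
      (2 * (1 + S.γ) + 4 * S.κ * (m / ‖ξ s‖))) (2 * (1 + S.γ) + 4 * S.κ * (m / ‖ξ s‖))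
    rw [sub_add_cancel] at h4
    rw [hH]; linarith
  have hdef := hr.norm_sub_direction_le hm hb hNe (fun s hs => (hfar s hs).2) hHbd hsmall
  obtain ⟨hxM, hpM, hNM, hplane⟩ := hr.isPlaneRay hm.le hNe hb hM1 hL
  set e := cross Ne M with he
  have he1 : ‖e‖ = 1 := by
    have := norm_cross_sq Ne M
    rw [hNe, hM1, hNM] at this
    rw [← sq_eq_sq₀ (norm_nonneg _) zero_le_one, he, this]; norm_num
  have hNe_e : inner ℝ Ne e = (0 : ℝ) := by rw [real_inner_comm]; exact inner_cross_self_left _ _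
  have hpz : ∀ s ≤ T, |inner ℝ (p s) Ne - 1| ≤ 4 * Real.pi * H * (m / b) := by
    intro s hs
    have h1 : (inner ℝ (p s) Ne - 1 : ℝ) = inner ℝ (p s - Ne) Ne := by
      rw [inner_sub_left, real_inner_self_eq_norm_sq, hNe, one_pow]
    rw [h1]
    refine (abs_real_inner_le_norm _ _).trans ?_
    rw [hNe, mul_one]
    exact hdef s hs
  have hpy : ∀ s ≤ T, |inner ℝ (p s) e| ≤ 4 * Real.pi * H * (m / b) := by
    intro s hs
    have h1 : (inner ℝ (p s) e : ℝ) = inner ℝ (p s - Ne) e := by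
      rw [inner_sub_left, hNe_e, sub_zero]
    rw [h1]
    refine (abs_real_inner_le_norm _ _).trans ?_
    rw [he1, mul_one]
    exact hdef s hs
  have hpz' : ∀ s ≤ T, 1 / 2 ≤ (inner ℝ (p s) Ne : ℝ) := fun s hs => by
    linarith [(abs_le.1 (hpz s hs)).1]
  have hz := hplane.tendsto_z hb hpz' fun s hs => (hpy s hs).trans hsmall.le
  -- By the triple product, y(T) = (x(T) × N_e) · M with M the unit angular momentum.
  have hside : (inner ℝ (ξ T) Ne : ℝ) < 0 ∨ 0 < (inner ℝ (ξ T) e : ℝ) := by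
    refine hside₀.imp_right fun h1 => ?_
    rw [he, ← inner_cross_rotate, hM, real_inner_smul_right, real_inner_comm]
    exact mul_pos (inv_pos.2 hb) h1
  have hy := hplane.y_pos hb hpz' hz hside
  have hmain := hplane.direction_expansion hm hb hK hy hz hpz hpy (fun s hs => (hfar s hs).2)
    (fun s hs => (hindex _ (hu s hs) (hfar s hs).1).2) σ hσ
  obtain ⟨hcross, hPe⟩ := cross_unit_of_plane hNe hM1 hNM (hxM σ hσ) rfl (hy σ hσ)
    (hr.norm_pos hm.le hσ)
  have hinner : (inner ℝ Ne (unit (ξ σ)) : ℝ) = inner ℝ (ξ σ) Ne / ‖ξ σ‖ := by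
    rw [unit, real_inner_smul_right, real_inner_comm]; ring
  rw [hcross, hPe, hinner]
  have hpdec := eq_smul_add_smul_of_orthonormal hNe hM1 hNM (hpM σ hσ)
  obtain ⟨hm1, hm2⟩ := hmain
  set α := m * (inner ℝ (ξ σ) e / ‖ξ σ‖) / b *
    (1 + S.γ + S.κ * m * (inner ℝ (ξ σ) e / ‖ξ σ‖) / b) with hα
  set β := m / b * ((1 + S.γ) * (1 + inner ℝ (ξ σ) Ne / ‖ξ σ‖) + S.κ * m / b *
    (Real.pi - Real.arccos (inner ℝ (ξ σ) Ne / ‖ξ σ‖) +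
      inner ℝ (ξ σ) e / ‖ξ σ‖ * (inner ℝ (ξ σ) Ne / ‖ξ σ‖))) with hβ
  have hfin : -p σ - (-Ne - α • Ne + β • e) =
      -(((inner ℝ (p σ) Ne : ℝ) - (1 + α)) • Ne + ((inner ℝ (p σ) e : ℝ) + β) • e) := by
    rw [← he] at hpdec
    calc -p σ - (-Ne - α • Ne + β • e)
        = -((inner ℝ (p σ) Ne : ℝ) • Ne + (inner ℝ (p σ) e : ℝ) • e) - (-Ne - α • Ne + β • e) := by
          rw [← hpdec]
      _ = _ := by module
  rw [hfin, norm_neg]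
  refine (norm_add_le _ _).trans ?_
  rw [norm_smul, norm_smul, hNe, he1, mul_one, mul_one, Real.norm_eq_abs, Real.norm_eq_abs]
  linarith

end LightRay

open LightRay in
theorem proposition7 (S : LightRay.Potentials) :
    ∃ δ₀ : ℝ, 0 < δ₀ ∧ ∃ C : ℝ,
      ∀ (m b : ℝ) (Ne : LightRay.Triple) (σR : ℝ) (x : ℝ → LightRay.Event),
        0 < m → 0 < b → m / b ≤ δ₀ → ‖Ne‖ = 1 →
        LightRay.IsQuasiMinkowskian S m Ne σR x →
        LightRay.HasImpactParameter S m σR x b →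
        ∀ (σB : ℝ), σB ≤ σR →
        ∀ (xB nB : LightRay.Triple),
          xB = LightRay.spatial (x σB) → nB = LightRay.unit xB →
          (∀ σ : ℝ, σ ≤ σB → S.rh m < ‖(σ - σB) • Ne + xB‖) →
          ‖LightRay.directionTriple (S.metric m) (Set.Iic σR) x σB -
            (-Ne
              - (m * ‖LightRay.cross Ne nB‖ / b *
                  (1 + S.γ + S.κ * m * ‖LightRay.cross Ne nB‖ / b)) • Ne
              + (m / b *
                  ((1 + S.γ) * (1 + inner ℝ Ne nB) +
                    S.κ * m / b *
                      (Real.pi - Real.arccos (inner ℝ Ne nB) +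
                        ‖LightRay.cross Ne nB‖ * inner ℝ Ne nB))) •
                LightRay.Pe Ne nB)‖ ≤ C * (m / b) ^ 3 := by
  obtain ⟨δ₀, hδ₀, C, hC⟩ := exists_direction_bound S
  refine ⟨δ₀, hδ₀, C, ?_⟩
  intro m b Ne T x hm hb hδ hNe hqm himp σ hσ xB nB hxB hnB _
  obtain ⟨p, w, τ, hr, hp, hside⟩ := hqm.exists_isRay hm hNe
  -- By conservation the limit defining b is that of an eventually constant function.
  have hLb : ‖cross (spatial (x T)) (p T)‖ = b := by
    refine tendsto_nhds_unique (tendsto_const_nhds.congr' ?_) himp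
    filter_upwards [eventually_le_atBot T] with s hs
    rw [angularMomentum, ← cross_neg_right, hp s hs, neg_neg, ← hr.cross_eq hs]
  have h := hC m b Ne T _ p w τ hm hb hδ hNe hr hLb hside σ hσ
  rw [hnB, hxB, hp σ hσ]
  exact h
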